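/- Let $k$ be a field, let $R=k[\![x,y,z,w,u]\!]/(xy)$, let $\mathfrak p=(x,z,w)\subseteq R$, let $M=\Omega^3_{R/(y)}(k)$ be a third syzygy of the residue field $k$ over the ring $R/(y)$, viewed as an $R$-module (that is, there is an exact sequence $0\to M\to (R/(y))^{a}\to (R/(y))^{b}\to (R/(y))^{c}\to k\to 0$ of $R/(y)$-modules with $a,b,c$ finite), and let $N=\operatorname{Tr}(R/\mathfrak p)$ be an Auslander transpose of $R/\mathfrak p$ over $R$ (that is, $N$ is the cokernel of the $R$-dual of the map $R^m\to R^n$ in some finite free presentation $R^m\to R^n\to R/\mathfrak p\to 0$). Here $\operatorname{depth}(0)=\infty$, and a finitely generated $R$-module $X$ satisfies $(S_n)$ if $\operatorname{depth}_{R_{\mathfrak q}}(X_{\mathfrak q})\ge\min\{n,\dim R_{\mathfrak q}\}$ for every $\mathfrak q\in\operatorname{Supp}_R(X)$. Then: 1. $R$ is a four-dimensional local hypersurface (a Noetherian local ring whose completion is $S/(f)$ with $S$ a complete regular local ring and $0\ne f\in\mathfrak m_S^2$), $\mathfrak p$ is a prime ideal of height $2$, and $R/(y)$ is a maximal Cohen–Macaulay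 $R$-module satisfying $(S_3)$. 2. $\operatorname{depth}_R(M)=3$, so $M$ is not maximal Cohen–Macaulay; moreover $\mathfrak p\notin\operatorname{Supp}_R(M)$ and $M$ satisfies $(S_3)$. 3. $\operatorname{pd}_R(N)=1$ and $\operatorname{Tor}_i^R(M,N)=0$ for all $i\ge 1$. 4. $M$ and $M\otimes_R N$ are both reflexive, and $N$ is torsion-free but not reflexive. This holds for every choice of the third syzygy $M$ and of the transpose $N$. -/

import Mathlib

universe u v

open CategoryTheory TensorProduct

namespace TensorReflexive

section Notions

/-- The depth of a finitely generated module over a local ring: the supremum of the lengths of the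
sequences in the maximal ideal that are weakly regular on `M`. For `M ≠ 0` finitely generated these
are, by Nakayama, exactly the `M`-regular sequences in the maximal ideal; for `M = 0` the depth
is `∞`. -/
noncomputable def depth (R : Type u) [CommRing R] [IsLocalRing R]
    (M : Type v) [AddCommGroup M] [Module R M] : ℕ∞ :=
  ⨆ (rs : List R) (_ : (∀ r ∈ rs, r ∈ IsLocalRing.maximalIdeal R) ∧
    RingTheory.Sequence.IsWeaklyRegular M rs), (rs.length : ℕ∞)

/-- Maximal Cohen-Macaulay modules over a local ring. -/
def IsMaximalCohenMacaulay (R : Type u) [CommRing R] [IsLocalRing R]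
    (M : Type v) [AddCommGroup M] [Module R M] : Prop :=
  Module.Finite R M ∧ ((depth R M : ℕ∞) : WithBot ℕ∞) = ringKrullDim R

/-- Serre's condition `(Sₙ)`: `depth M_𝔮 ≥ min {n, dim R_𝔮}` for all `𝔮` in the support of `M`. -/
def SatisfiesSerre (n : ℕ) (R : Type u) [CommRing R]
    (M : Type v) [AddCommGroup M] [Module R M] : Prop :=
  ∀ q ∈ Module.support R M,
    min (n : WithBot ℕ∞) (ringKrullDim (Localization.AtPrime q.asIdeal)) ≤
      ((depth (Localization.AtPrime q.asIdeal)
        (LocalizedModule.AtPrime q.asIdeal M) : ℕ∞) : WithBot ℕ∞)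

/-- Local hypersurface rings (complete intersections of codimension one): Noetherian local rings
whose completion is `S/(f)` with `S` a complete regular local ring and `0 ≠ f ∈ 𝔪_S²`. -/
def IsHypersurface (R : Type u) [CommRing R] [IsLocalRing R] : Prop :=
  IsNoetherianRing R ∧
    ∃ (S : Type u) (_ : CommRing S) (_ : IsRegularLocalRing S) (f : S),
      IsAdicComplete (IsLocalRing.maximalIdeal S) S ∧
      f ≠ 0 ∧ f ∈ IsLocalRing.maximalIdeal S ^ 2 ∧
      Nonempty (AdicCompletion (IsLocalRing.maximalIdeal R) R ≃+* S ⧸ Ideal.span {f})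

/-- `M` is a third syzygy of the `A`-module `X`: there is an exact sequence
`0 → M → Aᵃ → Aᵇ → Aᶜ → X → 0`. (Two third syzygies agree up to free direct summands; the one
obtained from a minimal free resolution is included.) -/
def IsThirdSyzygy (A : Type u) [CommRing A] (X : Type u) [AddCommGroup X] [Module A X]
    (M : Type u) [AddCommGroup M] [Module A M] : Prop :=
  ∃ (a b c : ℕ) (i : M →ₗ[A] (Fin a → A)) (d₂ : (Fin a → A) →ₗ[A] (Fin b → A))
    (d₁ : (Fin b → A) →ₗ[A] (Fin c → A)) (ε : (Fin c → A) →ₗ[A] X),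
    Function.Injective i ∧ Function.Exact i d₂ ∧ Function.Exact d₂ d₁ ∧
      Function.Exact d₁ ε ∧ Function.Surjective ε

/-- `N` is an Auslander transpose of `X`: for some finite free presentation
`Rᵐ → Rⁿ → X → 0`, with first map `φ`, `N` is the cokernel of `φ* : (Rⁿ)* → (Rᵐ)*`. -/
def IsAuslanderTranspose (R : Type u) [CommRing R] (X : Type u) [AddCommGroup X] [Module R X]
    (N : Type u) [AddCommGroup N] [Module R N] : Prop :=
  ∃ (m n : ℕ) (φ : (Fin m → R) →ₗ[R] (Fin n → R)) (ε : (Fin n → R) →ₗ[R] X)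
    (π : Module.Dual R (Fin m → R) →ₗ[R] N),
    Function.Exact φ ε ∧ Function.Surjective ε ∧
      Function.Exact φ.dualMap π ∧ Function.Surjective π

/-- Third syzygies of finitely generated modules over a Noetherian ring exist. -/
theorem exists_isThirdSyzygy (A : Type u) [CommRing A] [IsNoetherianRing A]
    (X : Type u) [AddCommGroup X] [Module A X] [Module.Finite A X] :
    ∃ (a : ℕ) (M : Submodule A (Fin a → A)), IsThirdSyzygy A X M := by
  obtain ⟨c, ε, hε⟩ := Module.Finite.exists_fin' A X
  obtain ⟨b, e₁, he₁⟩ := Module.Finite.exists_fin' A (LinearMap.ker ε)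
  obtain ⟨a, e₂, he₂⟩ := Module.Finite.exists_fin' A (LinearMap.ker e₁)
  refine ⟨a, LinearMap.ker e₂, a, b, c, Submodule.subtype _, (Submodule.subtype _).comp e₂,
    (Submodule.subtype _).comp e₁, ε, Subtype.val_injective, ?_, ?_, ?_, hε⟩
  all_goals
    rw [LinearMap.exact_iff]
    simp [LinearMap.ker_comp, LinearMap.range_comp, LinearMap.range_eq_top.2, he₁, he₂]

/-- Auslander transposes of finitely generated modules over a Noetherian ring exist. -/
theorem exists_isAuslanderTranspose (R : Type u) [CommRing R] [IsNoetherianRing R]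
    (X : Type u) [AddCommGroup X] [Module R X] [Module.Finite R X] :
    ∃ (m : ℕ) (U : Submodule R (Module.Dual R (Fin m → R))),
      IsAuslanderTranspose R X (Module.Dual R (Fin m → R) ⧸ U) := by
  obtain ⟨n, ε, hε⟩ := Module.Finite.exists_fin' R X
  obtain ⟨m, e, he⟩ := Module.Finite.exists_fin' R (LinearMap.ker ε)
  refine ⟨m, LinearMap.range ((Submodule.subtype _).comp e).dualMap, m, n,
    (Submodule.subtype _).comp e, ε, Submodule.mkQ _, ?_, hε, ?_, Submodule.mkQ_surjective _⟩
  · rw [LinearMap.exact_iff]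
    simp [LinearMap.range_comp, LinearMap.range_eq_top.2, he]
  · rw [LinearMap.exact_iff, Submodule.ker_mkQ]

end Notions

section Rings

/-- `R = k⟦x, y, z, w, u⟧ / (xy)`; the variables `x, y, z, w, u` are numbered `0, 1, 2, 3, 4`. -/
def R (k : Type u) [Field k] : Type u :=
  MvPowerSeries (Fin 5) k ⧸
    Ideal.span {(MvPowerSeries.X 0 * MvPowerSeries.X 1 : MvPowerSeries (Fin 5) k)}

noncomputable instance instCommRingR (k : Type u) [Field k] : CommRing (R k) :=
  inferInstanceAs (CommRing (MvPowerSeries (Fin 5) k ⧸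
    Ideal.span {(MvPowerSeries.X 0 * MvPowerSeries.X 1 : MvPowerSeries (Fin 5) k)}))

/-- The quotient map `k⟦x, y, z, w, u⟧ → R`. -/
noncomputable def toR (k : Type u) [Field k] : MvPowerSeries (Fin 5) k →+* R k :=
  Ideal.Quotient.mk _

theorem toR_surjective (k : Type u) [Field k] : Function.Surjective (toR k) :=
  Ideal.Quotient.mk_surjective

instance instIsNoetherianRingR (k : Type u) [Field k] : IsNoetherianRing (R k) :=
  isNoetherianRing_of_surjective _ _ (toR k) (toR_surjective k)

/-- The image in `R` of the variable number `i`. -/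
noncomputable def var (k : Type u) [Field k] (i : Fin 5) : R k :=
  toR k (MvPowerSeries.X i)

/-- The ideal `𝔭 = (x, z, w)` of `R`. -/
noncomputable def p (k : Type u) [Field k] : Ideal (R k) :=
  Ideal.span {var k 0, var k 2, var k 3}

/-- The ring `R/(y)`. -/
abbrev A (k : Type u) [Field k] : Type u := R k ⧸ Ideal.span {var k 1}

/-- Evaluation at the origin, `R → k`. -/
noncomputable def evalZero (k : Type u) [Field k] : R k →+* k :=
  Ideal.Quotient.lift _ (MvPowerSeries.constantCoeff (σ := Fin 5) (R := k)) fun a ha => by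
    have h : Ideal.span {(MvPowerSeries.X 0 * MvPowerSeries.X 1 : MvPowerSeries (Fin 5) k)} ≤
        RingHom.ker (MvPowerSeries.constantCoeff (σ := Fin 5) (R := k)) := by
      rw [Ideal.span_le]
      rintro _ rfl
      simp
    exact h ha

theorem evalZero_var (k : Type u) [Field k] (i : Fin 5) : evalZero k (var k i) = 0 :=
  (Ideal.Quotient.lift_mk _ _ _).trans (MvPowerSeries.constantCoeff_X i)

instance instNontrivialR (k : Type u) [Field k] : Nontrivial (R k) :=
  (evalZero k).domain_nontrivial

instance instIsLocalRingR (k : Type u) [Field k] : IsLocalRing (R k) :=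
  .of_surjective' (toR k) (toR_surjective k)

instance instNontrivialA (k : Type u) [Field k] : Nontrivial (A k) := by
  refine Ideal.Quotient.nontrivial_iff.2 fun h => ?_
  have h1 : Ideal.span {var k 1} ≤ RingHom.ker (evalZero k) := by
    rw [Ideal.span_le]
    rintro _ rfl
    exact evalZero_var k 1
  exact RingHom.ker_ne_top _ (top_le_iff.1 (h ▸ h1))

instance instIsLocalRingA (k : Type u) [Field k] : IsLocalRing (A k) :=
  .of_surjective' (Ideal.Quotient.mk _) Ideal.Quotient.mk_surjective

end Rings

end TensorReflexive

/-! Write x, y, z, w, u for the five variables and A = R/(y). The example works because y lies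
outside 𝔭 but kills M. Over R_𝔭 the element y is a unit, so x = 0 there, and the transpose of R/𝔭
becomes, up to free summands, the cokernel of the column (z, w) over a two-dimensional regular local
ring: torsion-free, not reflexive. M vanishes at 𝔭, and x, z, w is a regular sequence on it, so the
defect of N disappears in M ⊗ N. The proof carries this out globally, without localising at 𝔭.

The element z kills R/𝔭 and is regular on R and on M. Hence it is null-homotopic on a presentation φ
of R/𝔭, so φ* is injective and stays so after tensoring with M. This gives a two-term projective
resolution of N and the vanishing of Tor; N is not projective, since otherwise φ would be onto.

By `exists_retract_transpose` the other properties of N can be checked on K, the cokernel of (x, z,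
w) : R → R³. The Koszul complex identifies M ⊗ K with the kernel of a map M³ → M
(`koszulFactor_injective`, `exact_koszulFactor`), and `isReflexive_of_exact` makes such a kernel
reflexive because multiplication by z factors through its inclusion. The same criterion gives
reflexivity of M inside Aᵃ. Over R itself K still embeds in R³, which needs only z, w regular, but
since yx = 0 an explicit functional on K* is not an evaluation (`not_isReflexive_koszulCokernel`).

For depth, vanishing of Ext from the residue field records lengths of regular sequences. Since A has
depth 4 = dim R, every prime 𝔮 contains an A-regular sequence of length ht 𝔮
(`exists_isWeaklyRegular_of_le_height`); those of length at most 3 are M-regular by the depth lemma.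
A fourth regular element on M would, by dimension shifting, force Hom(k, k) = 0. -/

namespace TensorReflexive

/-! ### Regular sequences, Ext vanishing and depth. -/

section Depth

open Abelian RingTheory.Sequence
open scoped Pointwise

section Ext

variable {R : Type u} [CommRing R] {M : Type u} [AddCommGroup M] [Module R M] {K : ModuleCat.{u} R}

theorem subsingleton_ext_quotSMulTop {r : R} (hr : IsSMulRegular M r) {n : ℕ}
    (h : ∀ i < n + 1, Subsingleton (Ext K (ModuleCat.of R M) i)) :
    ∀ i < n, Subsingleton (Ext K (ModuleCat.of R (QuotSMulTop r M)) i) := by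
  intro i hi
  have h1 := h i (by omega)
  have h2 := h (i + 1) (by omega)
  have hS := IsSMulRegular.smulShortComplex_shortExact (M := ModuleCat.of R M) hr
  refine subsingleton_of_forall_eq 0 fun e => ?_
  obtain ⟨e', rfl⟩ := Ext.covariant_sequence_exact₃ K hS e rfl (h2.elim _ _)
  exact (congrArg (fun t => Ext.comp t _ _) (h1.elim e' 0)).trans (Ext.zero_comp _ _ _ _ _)

/-- An element killing K acts as zero on Ext(K, M). So Ext⁰ embeds in itself by the zero map, and
each Extⁱ⁺¹(K, M) is covered by Extⁱ(K, M/rM), to which induction applies. -/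
theorem subsingleton_ext_of_isWeaklyRegular {rs : List R}
    (hK : ∀ r ∈ rs, r ∈ Module.annihilator R K) (h : IsWeaklyRegular M rs) :
    ∀ i < rs.length, Subsingleton (Ext K (ModuleCat.of R M) i) := by
  induction rs generalizing M with
  | nil => simp
  | cons r rs ih =>
    rw [isWeaklyRegular_cons_iff] at h
    have ih' := ih (fun s hs => hK s (by simp [hs])) h.2
    have hS := IsSMulRegular.smulShortComplex_shortExact (M := ModuleCat.of R M) h.1
    have hz : r • 𝟙 K = 0 := by
      ext x
      exact Module.mem_annihilator.1 (hK r (by simp)) x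
    have key : ∀ (i : ℕ) (e : Ext K (ModuleCat.of R M) i),
        e.comp (Ext.mk₀ ((ModuleCat.of R M).smulShortComplex r).f) (add_zero i) = 0 := by
      intro i e
      rw [ModuleCat.smulShortComplex_f_eq_smul_id]
      refine (Ext.smul_eq_comp_mk₀ e r).symm.trans ?_
      have : r • e = (Ext.mk₀ (r • 𝟙 K)).comp e (zero_add i) := by simp [Ext.mk₀_smul]
      rw [this, hz, Ext.mk₀_zero, Ext.zero_comp]
      rfl
    intro i hi
    refine subsingleton_of_forall_eq 0 fun e => ?_
    cases i with
    | zero =>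
      have := hS.mono_f
      refine (injective_iff_map_eq_zero _).1
        (Ext.postcomp_mk₀_injective_of_mono K ((ModuleCat.of R M).smulShortComplex r).f) e (key 0 e)
    | succ i =>
      obtain ⟨e', rfl⟩ := Ext.covariant_sequence_exact₁ K hS e (key _ e) rfl
      have := ih' i (by simpa using hi)
      exact (congrArg (fun t => Ext.comp t _ _) (this.elim e' 0)).trans (Ext.zero_comp _ _ _ _ _)

theorem subsingleton_ext_of_exact {M F Z : Type u} [AddCommGroup M] [Module R M] [AddCommGroup F]
    [Module R F] [AddCommGroup Z] [Module R Z] {f : M →ₗ[R] F} {g : F →ₗ[R] Z}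
    (hf : Function.Injective f) (hfg : Function.Exact f g) (hg : Function.Surjective g) {n : ℕ}
    (hF : Subsingleton (Ext K (ModuleCat.of R F) n))
    (hM : Subsingleton (Ext K (ModuleCat.of R M) (n + 1))) :
    Subsingleton (Ext K (ModuleCat.of R Z) n) := by
  let S : ShortComplex (ModuleCat.{u} R) :=
    ShortComplex.mk (ModuleCat.ofHom f) (ModuleCat.ofHom g) (by
      ext x
      exact hfg.apply_apply_eq_zero x)
  have hS : S.ShortExact := by
    have := (ModuleCat.mono_iff_injective S.f).2 hf
    have := (ModuleCat.epi_iff_surjective S.g).2 hg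
    exact .mk ((ShortComplex.ShortExact.moduleCat_exact_iff_function_exact S).2 hfg)
  refine subsingleton_of_forall_eq 0 fun e => ?_
  obtain ⟨e', rfl⟩ := Ext.covariant_sequence_exact₃ K hS e rfl (hM.elim _ _)
  exact (congrArg (fun t => Ext.comp t _ _) (hF.elim e' 0)).trans (Ext.zero_comp _ _ _ _ _)

theorem exists_isSMulRegular_of_subsingleton_ext_zero [IsNoetherianRing R] [Module.Finite R M]
    [Module.Finite R K] (h : Subsingleton (Ext K (ModuleCat.of R M) 0)) :
    ∃ r ∈ Module.annihilator R K, IsSMulRegular M r := by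
  rw [← IsSMulRegular.subsingleton_linearMap_iff]
  have h1 : Subsingleton (K ⟶ ModuleCat.of R M) := Ext.homEquiv₀.symm.subsingleton
  exact (ModuleCat.homEquiv (M := K) (N := ModuleCat.of R M)).symm.subsingleton

end Ext

section Local

variable {R : Type u} [CommRing R] [IsLocalRing R]

theorem le_depth {M : Type v} [AddCommGroup M] [Module R M] {rs : List R}
    (h : ∀ r ∈ rs, r ∈ IsLocalRing.maximalIdeal R) (hM : IsWeaklyRegular M rs) :
    (rs.length : ℕ∞) ≤ depth R M :=
  le_iSup₂_of_le rs ⟨h, hM⟩ le_rfl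

theorem depth_le {M : Type v} [AddCommGroup M] [Module R M] {n : ℕ}
    (h : ∀ rs : List R, (∀ r ∈ rs, r ∈ IsLocalRing.maximalIdeal R) → IsWeaklyRegular M rs →
      rs.length ≤ n) : depth R M ≤ n :=
  iSup₂_le fun rs hrs => by exact_mod_cast h rs hrs.1 hrs.2

theorem le_depth_localizedModule {R : Type u} [CommRing R] {M : Type v} [AddCommGroup M]
    [Module R M] (q : Ideal R) [q.IsPrime] {rs : List R} (h : ∀ r ∈ rs, r ∈ q)
    (hM : IsWeaklyRegular M rs) :
    (rs.length : ℕ∞) ≤ depth (Localization.AtPrime q) (LocalizedModule.AtPrime q M) := by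
  have h1 : IsWeaklyRegular (LocalizedModule.AtPrime q M)
      (rs.map (algebraMap R (Localization.AtPrime q))) :=
    hM.of_isLocalizedModule (Localization.AtPrime q) q.primeCompl
      (LocalizedModule.mkLinearMap q.primeCompl M)
  simpa using le_depth (by
    intro r hr
    obtain ⟨s, hs, rfl⟩ := List.mem_map.1 hr
    exact (IsLocalization.AtPrime.to_map_mem_maximal_iff _ q s).2 (h s hs)) h1

variable [IsNoetherianRing R] {M : Type u} [AddCommGroup M] [Module R M] [Module.Finite R M]

/-- Let N be the submodule killed by P. If N were inside rM, regularity of r would give N = rN, so N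
= 0 by Nakayama. Hence some y in N is nonzero modulo rM, and its class is killed by both P and r. -/
theorem exists_associatedPrime_quotSMulTop {r : R} (hr : IsSMulRegular M r)
    (hrm : r ∈ IsLocalRing.maximalIdeal R) {P : Ideal R} (hP : P ∈ associatedPrimes R M) :
    ∃ P' ∈ associatedPrimes R (QuotSMulTop r M), P ≤ P' ∧ r ∈ P' := by
  obtain ⟨hPp, x, hx⟩ := isAssociatedPrime_iff.1 (AssociatedPrimes.mem_iff.1 hP)
  let N : Submodule R M := Submodule.torsionBySet R M P
  have hxN : x ∈ N := by
    refine (Submodule.mem_torsionBySet_iff _ _).2 fun a => ?_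
    have : (a : R) ∈ (⊥ : Submodule R M).colon {x} := hx ▸ a.2
    simpa using this
  have hx0 : x ≠ 0 := by
    rintro rfl
    apply hPp.ne_top
    rw [hx]
    simp
  have hN : ∃ y ∈ N, y ∉ r • (⊤ : Submodule R M) := by
    by_contra! hcon
    have hle : N ≤ IsLocalRing.maximalIdeal R • N := by
      intro y hy
      obtain ⟨z, -, rfl⟩ := (Submodule.mem_smul_pointwise_iff_exists _ _ _).1 (hcon y hy)
      refine Submodule.smul_mem_smul hrm ((Submodule.mem_torsionBySet_iff _ _).2 fun a => ?_)
      have h1 := (Submodule.mem_torsionBySet_iff _ _).1 hy a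
      refine hr ?_
      simpa [smul_comm r] using h1
    have := Submodule.eq_bot_of_le_smul_of_le_jacobson_bot (IsLocalRing.maximalIdeal R) N
      (IsNoetherian.noetherian N) hle (IsLocalRing.maximalIdeal_le_jacobson _)
    rw [this] at hxN
    exact hx0 (by simpa using hxN)
  obtain ⟨y, hyN, hy⟩ := hN
  obtain ⟨P', hP', hle⟩ := exists_le_isAssociatedPrime_of_isNoetherianRing R
    (Submodule.Quotient.mk (p := r • (⊤ : Submodule R M)) y)
    (by rwa [Ne, Submodule.Quotient.mk_eq_zero])
  refine ⟨P', hP', fun a ha => hle ?_, hle ?_⟩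
  · have h1 := (Submodule.mem_torsionBySet_iff _ _).1 hyN ⟨a, ha⟩
    have : a • y = 0 := h1
    simp [Submodule.mem_colon_singleton, ← Submodule.Quotient.mk_smul, this]
  · rw [Submodule.mem_colon_singleton, ← Submodule.Quotient.mk_smul, Submodule.mem_bot,
      Submodule.Quotient.mk_eq_zero]
    exact Submodule.smul_mem_pointwise_smul _ _ _ trivial

variable {K : ModuleCat.{u} R} [Module.Finite R K]

/-- Dividing by a regular element replaces P by a strictly larger associated prime, because P
consists of zero divisors. Each vanishing Ext therefore costs one step in a chain of primes. -/
theorem add_height_le_ringKrullDim_of_associatedPrime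
    (hK : Module.annihilator R K = IsLocalRing.maximalIdeal R) {n : ℕ}
    (h : ∀ i < n, Subsingleton (Ext K (ModuleCat.of R M) i)) {P : Ideal R}
    (hP : P ∈ associatedPrimes R M) :
    (((n : ℕ∞) + P.height : ℕ∞) : WithBot ℕ∞) ≤ ringKrullDim R := by
  have hPp := (AssociatedPrimes.mem_iff.1 hP).isPrime
  induction n generalizing M P with
  | zero => simpa using Ideal.height_le_ringKrullDim_of_isPrime
  | succ n ih =>
    obtain ⟨r, hrK, hr⟩ := exists_isSMulRegular_of_subsingleton_ext_zero (h 0 (by omega))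
    obtain ⟨P', hP', hle, hrP⟩ := exists_associatedPrime_quotSMulTop hr (hK ▸ hrK) hP
    have hPp' := (AssociatedPrimes.mem_iff.1 hP').isPrime
    have hrP0 : r ∉ P := by
      intro hrP0
      obtain ⟨x, hx⟩ := (isAssociatedPrime_iff.1 (AssociatedPrimes.mem_iff.1 hP)).2
      have : r • x = r • 0 := by
        rw [hx] at hrP0
        simpa using hrP0
      have hx0 := hr this
      rw [hx0] at hx
      exact hPp.ne_top (by rw [hx]; simp)
    have h2 := Ideal.height_add_one_le_of_lt_of_isPrime
      (lt_of_le_of_ne hle fun h => hrP0 (h ▸ hrP))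
    refine le_trans ?_ (ih (subsingleton_ext_quotSMulTop hr h) hP' hPp')
    refine WithBot.coe_le_coe.2 ?_
    push_cast
    rw [add_assoc, add_comm 1]
    gcongr

/-- Here `e` counts the remaining degrees of vanishing and `c` the regular elements already divided
out. If q had no regular element, prime avoidance would put q in an associated prime P; then e + ht
P ≤ e + c, against ht q > c. -/
theorem exists_isWeaklyRegular_of_le_height
    (hK : Module.annihilator R K = IsLocalRing.maximalIdeal R) {e c n : ℕ}
    (hdim : ringKrullDim R ≤ (e + c : ℕ))
    (h : ∀ i < e, Subsingleton (Ext K (ModuleCat.of R M) i)) (q : Ideal R) [q.IsPrime]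
    (hq : ((n + c : ℕ) : ℕ∞) ≤ q.height) :
    ∃ rs : List R, rs.length = n ∧ (∀ r ∈ rs, r ∈ q) ∧ IsWeaklyRegular M rs := by
  induction n generalizing M e c with
  | zero => exact ⟨[], rfl, by simp, .nil R M⟩
  | succ n ih =>
    have hreg : ∃ r ∈ q, IsSMulRegular M r := by
      by_contra! hcon
      obtain ⟨P, hP, hqP⟩ : ∃ P ∈ associatedPrimes R M, q ≤ P := by
        cases subsingleton_or_nontrivial M
        · exact absurd (fun _ _ _ => Subsingleton.elim _ _) (hcon 0 q.zero_mem)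
        obtain ⟨Ia, hIa⟩ := associatedPrimes.nonempty R M
        refine (Ideal.subset_union_prime_finite (associatedPrimes.finite R M) Ia Ia
          fun I hin _ _ ↦ IsAssociatedPrime.isPrime hin).mp ?_
        rw [biUnion_associatedPrimes_eq_compl_regular R M]
        exact fun r hr ↦ hcon r hr
      have hPp := (AssociatedPrimes.mem_iff.1 hP).isPrime
      have h1 := (add_height_le_ringKrullDim_of_associatedPrime hK h hP).trans hdim
      have h2 := hq.trans (Ideal.height_mono hqP)
      have h3 : ((e : ℕ∞) + P.height) ≤ (e + c : ℕ) := by exact_mod_cast h1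
      push_cast at h2 h3
      have h4 := (add_le_add_right h2 (e : ℕ∞)).trans h3
      norm_cast at h4
      omega
    obtain ⟨r, hrq, hr⟩ := hreg
    obtain ⟨e, rfl⟩ : ∃ e', e = e' + 1 := by
      refine Nat.exists_eq_succ_of_ne_zero ?_
      rintro rfl
      have h1 := (WithBot.coe_le_coe.2 hq).trans
        (Ideal.height_le_ringKrullDim_of_isPrime.trans hdim)
      norm_cast at h1
      omega
    obtain ⟨rs, hlen, hmem, hrs⟩ := ih (M := QuotSMulTop r M) (e := e) (c := c + 1)
      (by rw [add_right_comm] at hdim; exact hdim) (subsingleton_ext_quotSMulTop hr h)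
      (by rwa [add_right_comm] at hq)
    exact ⟨r :: rs, by simp [hlen], by simpa [hrq] using hmem, .cons hr hrs⟩

end Local

section Syzygy

variable {R : Type u} [CommRing R]

/-- The depth lemma for sequences: if r is regular on Z, the exact sequence stays exact modulo r.
The last element only has to be regular on F, so Z is tested on one element fewer. -/
theorem isWeaklyRegular_of_exact {M F Z : Type v} [AddCommGroup M] [Module R M] [AddCommGroup F]
    [Module R F] [AddCommGroup Z] [Module R Z] {i : M →ₗ[R] F} {d : F →ₗ[R] Z}
    (hi : Function.Injective i) (hd : Function.Exact i d) (hs : Function.Surjective d)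
    {rs : List R} (hF : IsWeaklyRegular F rs) (hZ : IsWeaklyRegular Z rs.dropLast) :
    IsWeaklyRegular M rs := by
  induction rs generalizing M F Z with
  | nil => exact .nil R M
  | cons r rs ih =>
    rw [isWeaklyRegular_cons_iff] at hF ⊢
    refine ⟨hF.1.of_injective i hi, ?_⟩
    cases rs with
    | nil => exact .nil R _
    | cons s t =>
      rw [List.dropLast_cons_cons, isWeaklyRegular_cons_iff] at hZ
      refine ih (i := QuotSMulTop.map r i) (d := QuotSMulTop.map r d) ?_
        (QuotSMulTop.map_exact r hd hs) (QuotSMulTop.map_surjective r hs) hF.2 hZ.2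
      rw [injective_iff_map_eq_zero]
      intro m hm
      obtain ⟨m, rfl⟩ := Submodule.Quotient.mk_surjective _ m
      have h1 : i m ∈ r • (⊤ : Submodule R F) := (Submodule.Quotient.mk_eq_zero _).1 hm
      obtain ⟨f, -, hf⟩ := (Submodule.mem_smul_pointwise_iff_exists _ _ _).1 h1
      have h2 : d f = 0 := hZ.1 (by
        simp only [smul_zero]
        rw [← map_smul, hf]
        exact hd.apply_apply_eq_zero m)
      obtain ⟨m', rfl⟩ := (hd f).1 h2
      rw [← map_smul] at hf
      rw [Submodule.Quotient.mk_eq_zero, ← hi hf]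
      exact Submodule.smul_mem_pointwise_smul _ _ _ trivial

end Syzygy

end Depth

/-! ### Lifting and descending maps along exact sequences. -/

section Lifting

variable {R : Type*} [CommRing R] {P F G H : Type*} [AddCommGroup P] [Module R P] [AddCommGroup F]
  [Module R F] [AddCommGroup G] [Module R G] [AddCommGroup H] [Module R H]

theorem exists_lift_of_exact [Module.Projective R P] {φ : F →ₗ[R] G} {ε : G →ₗ[R] H}
    (h : Function.Exact φ ε) (g : P →ₗ[R] G) (hg : ∀ p, ε (g p) = 0) :
    ∃ l : P →ₗ[R] F, ∀ p, φ (l p) = g p := by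
  obtain ⟨l, hl⟩ := Module.projective_lifting_property φ.rangeRestrict
    (g.codRestrict (LinearMap.range φ) fun p => (h (g p)).1 (hg p)) φ.surjective_rangeRestrict
  exact ⟨l, fun p => congrArg Subtype.val (LinearMap.congr_fun hl p)⟩

theorem exists_desc_of_exact {φ : F →ₗ[R] G} {π : G →ₗ[R] H} (h : Function.Exact φ π)
    (hπ : Function.Surjective π) (g : G →ₗ[R] P) (hg : ∀ x, g (φ x) = 0) :
    ∃ l : H →ₗ[R] P, ∀ x, l (π x) = g x := by
  refine ⟨((LinearMap.ker π).liftQ g fun x hx => ?_).comp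
    (π.quotKerEquivOfSurjective hπ).symm.toLinearMap, fun x => ?_⟩
  · obtain ⟨y, rfl⟩ := (h x).1 hx
    exact hg y
  · have : (π.quotKerEquivOfSurjective hπ).symm (π x) = Submodule.Quotient.mk x := by
      rw [LinearEquiv.symm_apply_eq]
      rfl
    simp [this]

/-- An element annihilating `X` acts null-homotopically on an exact complex of projective modules
over `X`, up to the second syzygy. -/
theorem exists_retraction_of_exact {M F₂ F₁ F₀ X : Type*} [AddCommGroup M] [Module R M]
    [AddCommGroup F₂] [Module R F₂] [AddCommGroup F₁] [Module R F₁] [AddCommGroup F₀] [Module R F₀]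
    [AddCommGroup X] [Module R X] [Module.Projective R F₂] [Module.Projective R F₁]
    [Module.Projective R F₀] {i : M →ₗ[R] F₂} {d₂ : F₂ →ₗ[R] F₁} {d₁ : F₁ →ₗ[R] F₀}
    {ε : F₀ →ₗ[R] X} (hi : Function.Injective i) (h₂ : Function.Exact i d₂)
    (h₁ : Function.Exact d₂ d₁) (h₀ : Function.Exact d₁ ε) (c : R) (hc : ∀ x : X, c • x = 0) :
    ∃ h : F₂ →ₗ[R] M, ∀ m, h (i m) = c • m := by
  obtain ⟨s₀, hs₀⟩ := exists_lift_of_exact h₀ (c • LinearMap.id) fun p => by simp [hc]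
  obtain ⟨s₁, hs₁⟩ := exists_lift_of_exact h₁ (c • LinearMap.id - s₀ ∘ₗ d₁) fun p => by
    simp [hs₀]
  obtain ⟨s₂, hs₂⟩ := exists_lift_of_exact h₂ (c • LinearMap.id - s₁ ∘ₗ d₂) fun p => by
    simp [hs₁, h₁.apply_apply_eq_zero]
  refine ⟨s₂, fun m => hi ?_⟩
  simp [hs₂, h₂.apply_apply_eq_zero]

end Lifting

/-! ### Two criteria for reflexivity. -/

section Reflexive

open Module

variable {R : Type*} [CommRing R]

/-- The kernel of a map from a reflexive module to a torsionless module is reflexive as soon as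
its inclusion splits up to a nonzerodivisor. -/
theorem isReflexive_of_exact {M F G : Type*} [AddCommGroup M] [Module R M] [AddCommGroup F]
    [Module R F] [AddCommGroup G] [Module R G] {i : M →ₗ[R] F} {d : F →ₗ[R] G}
    (hi : Function.Injective i) (hd : Function.Exact i d) (hF : IsReflexive R F)
    (hG : Function.Injective (Dual.eval R G)) {c : R} (hc : IsSMulRegular R c) (h : F →ₗ[R] M)
    (hh : ∀ m, h (i m) = c • m) : IsReflexive R M := by
  refine ⟨(injective_iff_map_eq_zero _).2 fun m hm => ?_, fun Φ => ?_⟩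
  · refine hi ?_
    rw [map_zero]
    refine (bijective_dual_eval R F).1 ?_
    ext f
    simpa using LinearMap.congr_fun hm (f ∘ₗ i)
  · obtain ⟨f, hf⟩ := (bijective_dual_eval R F).2 (Φ ∘ₗ i.dualMap)
    have hf' : ∀ g : Dual R F, g f = Φ (g ∘ₗ i) := fun g => LinearMap.congr_fun hf g
    -- Every functional of the form g ∘ d dies on M, so d f is killed by all functionals and
    -- vanishes, G being torsionless.
    obtain ⟨m, rfl⟩ : f ∈ Set.range i := by
      refine (hd f).1 (hG ?_)
      ext g
      have h0 : (g ∘ₗ d) ∘ₗ i = 0 := by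
        ext m
        simp [hd.apply_apply_eq_zero]
      simpa [h0] using hf' (g ∘ₗ d)
    refine ⟨m, ?_⟩
    ext g
    refine hc ?_
    -- A functional g on M need not extend to F, but c • g does, as g ∘ h. This determines Φ up to
    -- the factor c, which cancels.
    have h1 : (g ∘ₗ h) ∘ₗ i = c • g := by
      ext m
      simp [hh]
    have := hf' (g ∘ₗ h)
    rw [h1] at this
    simpa [hh] using this

theorem isReflexive_pi {M : Type*} [AddCommGroup M] [Module R M] (hM : IsReflexive R M) (n : ℕ) :
    IsReflexive R (Fin n → M) := by
  induction n with
  | zero => infer_instance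
  | succ n ih => exact Module.equiv (Fin.consLinearEquiv R fun _ : Fin (n + 1) => M)

/-- Since ann(y) = (x) and ann(x) = (y), the dual of R/(y) is cyclic, generated by multiplication by
x, and is again a copy of R/(y). -/
theorem isReflexive_quotient_span_singleton {x y : R} (hxy : ∀ a, y * a = 0 ↔ ∃ b, a = x * b)
    (hyx : ∀ a, x * a = 0 ↔ ∃ b, a = y * b) : IsReflexive R (R ⧸ Ideal.span {y}) := by
  have hmem : ∀ r ∈ Ideal.span {y}, x * r = 0 := fun r hr => by
    obtain ⟨b, rfl⟩ := Ideal.mem_span_singleton'.1 hr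
    exact (hyx _).2 ⟨b, mul_comm _ _⟩
  let ξ : Dual R (R ⧸ Ideal.span {y}) := (Ideal.span {y}).liftQ (LinearMap.mulLeft R x) hmem
  have hξ : ∀ r, ξ (Ideal.Quotient.mk _ r) = x * r := fun r => rfl
  have hdual : ∀ g : Dual R (R ⧸ Ideal.span {y}), ∃ b : R, g = b • ξ := by
    intro g
    have h1 : y * g (Ideal.Quotient.mk _ 1) = 0 := by
      rw [← smul_eq_mul, ← map_smul]
      have : y • (Ideal.Quotient.mk (Ideal.span {y}) 1) = 0 := by
        rw [Algebra.smul_def, map_one, mul_one]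
        exact Ideal.Quotient.eq_zero_iff_mem.2 (Ideal.mem_span_singleton_self y)
      rw [this, map_zero]
    obtain ⟨b, hb⟩ := (hxy _).1 h1
    refine ⟨b, ?_⟩
    ext
    change g (Ideal.Quotient.mk _ 1) = b * ξ (Ideal.Quotient.mk _ 1)
    rw [hb, hξ]
    ring
  refine ⟨(injective_iff_map_eq_zero _).2 fun a ha => ?_, fun Φ => ?_⟩
  · obtain ⟨r, rfl⟩ := Ideal.Quotient.mk_surjective a
    have h1 : ξ (Ideal.Quotient.mk _ r) = 0 := LinearMap.congr_fun ha ξ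
    rw [hξ] at h1
    obtain ⟨b, rfl⟩ := (hyx _).1 h1
    exact Ideal.Quotient.eq_zero_iff_mem.2 (Ideal.mul_mem_right _ _ (Ideal.mem_span_singleton_self y))
  · have h1 : y * Φ ξ = 0 := by
      rw [← smul_eq_mul, ← map_smul]
      have : y • ξ = 0 := by
        ext
        change y * ξ (Ideal.Quotient.mk _ 1) = 0
        rw [hξ]
        exact (hxy _).2 ⟨1, rfl⟩
      rw [this, map_zero]
    obtain ⟨r, hr⟩ := (hxy _).1 h1
    refine ⟨Ideal.Quotient.mk _ r, ?_⟩
    ext g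
    obtain ⟨b, rfl⟩ := hdual g
    rw [Dual.eval_apply, map_smul, hr, LinearMap.smul_apply, hξ]

end Reflexive

/-! ### Comparison of Auslander transposes. -/

section Transpose

open Module

variable {R : Type*} [CommRing R]

/-- Schanuel's lemma for transposes: each transpose of `X` is a retract of any other one plus a
free module. -/
theorem exists_retract_transpose {F₁ F₀ F₁' F₀' X N N' : Type*} [AddCommGroup F₁] [Module R F₁]
    [AddCommGroup F₀] [Module R F₀] [AddCommGroup F₁'] [Module R F₁'] [AddCommGroup F₀']
    [Module R F₀'] [AddCommGroup X] [Module R X] [AddCommGroup N] [Module R N] [AddCommGroup N']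
    [Module R N'] [Projective R F₁] [Projective R F₀] [Projective R F₁'] [Projective R F₀']
    {φ : F₁ →ₗ[R] F₀} {ε : F₀ →ₗ[R] X} {π : Dual R F₁ →ₗ[R] N}
    {φ' : F₁' →ₗ[R] F₀'} {ε' : F₀' →ₗ[R] X} {π' : Dual R F₁' →ₗ[R] N'}
    (h : Function.Exact φ ε) (hε : Function.Surjective ε) (hφ : Function.Exact φ.dualMap π)
    (hπ : Function.Surjective π) (h' : Function.Exact φ' ε') (hε' : Function.Surjective ε')
    (hφ' : Function.Exact φ'.dualMap π') (hπ' : Function.Surjective π') :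
    ∃ (s : N →ₗ[R] N' × Dual R F₁) (r : N' × Dual R F₁ →ₗ[R] N), r ∘ₗ s = LinearMap.id := by
  obtain ⟨β₀, hβ₀⟩ := projective_lifting_property ε' ε hε'
  obtain ⟨α₀, hα₀⟩ := projective_lifting_property ε ε' hε
  replace hβ₀ := LinearMap.congr_fun hβ₀
  replace hα₀ := LinearMap.congr_fun hα₀
  simp only [LinearMap.comp_apply] at hβ₀ hα₀
  obtain ⟨β₁, hβ₁⟩ := exists_lift_of_exact h' (β₀ ∘ₗ φ) fun p => by
    simp [hβ₀, h.apply_apply_eq_zero]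
  obtain ⟨α₁, hα₁⟩ := exists_lift_of_exact h (α₀ ∘ₗ φ') fun p => by
    simp [hα₀, h'.apply_apply_eq_zero]
  obtain ⟨s, hs⟩ := exists_lift_of_exact h (α₀ ∘ₗ β₀ - LinearMap.id) fun p => by
    simp [hα₀, hβ₀]
  obtain ⟨b, hb⟩ := exists_desc_of_exact hφ' hπ' (π ∘ₗ β₁.dualMap) fun f => by
    have : β₁.dualMap (φ'.dualMap f) = φ.dualMap (β₀.dualMap f) := by
      ext p
      simpa using congrArg f (hβ₁ p)
    simp [this, hφ.apply_apply_eq_zero]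
  obtain ⟨a, ha⟩ := exists_desc_of_exact hφ hπ (π' ∘ₗ α₁.dualMap) fun f => by
    have : α₁.dualMap (φ.dualMap f) = φ'.dualMap (α₀.dualMap f) := by
      ext p
      simpa using congrArg f (hα₁ p)
    simp [this, hφ'.apply_apply_eq_zero]
  -- The part of α₁β₁ − id not explained by the homotopy s lands in ker φ. Its dual then kills the
  -- image of φ* and descends to τ : N → F₁*, so that b ∘ a − π ∘ τ = id.
  let t : F₁ →ₗ[R] F₁ := α₁ ∘ₗ β₁ - LinearMap.id - s ∘ₗ φ
  obtain ⟨τ, hτ⟩ := exists_desc_of_exact hφ hπ t.dualMap fun f => by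
    ext p
    have : φ (t p) = 0 := by
      simp only [LinearMap.comp_apply] at hα₁ hβ₁
      simp [t, hα₁, hβ₁, hs]
    simp [this]
  refine ⟨a.prod τ, b.coprod (-π), ?_⟩
  ext n
  obtain ⟨f, rfl⟩ := hπ n
  have h1 : β₁.dualMap (α₁.dualMap f) = f + φ.dualMap (s.dualMap f) + t.dualMap f := by
    ext p
    simp [t]
  have h2 := congrArg π h1
  simp only [map_add, hφ.apply_apply_eq_zero] at h2
  simp only [LinearMap.comp_apply] at ha hb
  simp [ha, hb, hτ, h2]

variable {F₁ F₀ X N : Type*} [AddCommGroup F₁] [Module R F₁]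
  [AddCommGroup F₀] [Module R F₀] [AddCommGroup X] [Module R X] [AddCommGroup N] [Module R N]
  {φ : F₁ →ₗ[R] F₀} {ε : F₀ →ₗ[R] X} {π : Dual R F₁ →ₗ[R] N}

theorem exists_homotopy_of_presentation [Projective R F₀] (h : Function.Exact φ ε) {c : R}
    (hc : ∀ x : X, c • x = 0) :
    ∃ s : Dual R F₁ →ₗ[R] Dual R F₀, ∀ f, s (φ.dualMap f) = c • f := by
  obtain ⟨s, hs⟩ := exists_lift_of_exact h (c • LinearMap.id) fun p => by simp [hc]
  refine ⟨s.dualMap, fun f => ?_⟩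
  ext p
  simp [hs]

/-- If N is projective, φ* has a retraction ρ; dualising ρ and using reflexivity produces preimages
under φ. -/
theorem surjective_of_projective_transpose [IsReflexive R F₁] [IsReflexive R F₀]
    [Projective R (Dual R F₁)] (hinj : Function.Injective φ.dualMap)
    (hφ : Function.Exact φ.dualMap π) (hπ : Function.Surjective π) [Projective R N] :
    Function.Surjective φ := by
  obtain ⟨σ, hσ⟩ := projective_lifting_property π LinearMap.id hπ
  replace hσ := LinearMap.congr_fun hσ
  simp only [LinearMap.comp_apply, LinearMap.id_apply] at hσ
  obtain ⟨ρ, hρ⟩ := exists_lift_of_exact hφ (LinearMap.id - σ ∘ₗ π) fun p => by simp [hσ]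
  intro f
  obtain ⟨g, hg⟩ := (bijective_dual_eval R F₁).2 (Dual.eval R F₀ f ∘ₗ ρ)
  refine ⟨g, (bijective_dual_eval R F₀).1 ?_⟩
  ext ξ
  have h1 : ρ (φ.dualMap ξ) = ξ := hinj (by rw [hρ]; simp [hφ.apply_apply_eq_zero])
  have h2 := LinearMap.congr_fun hg (φ.dualMap ξ)
  rw [LinearMap.comp_apply, h1] at h2
  simpa using h2

end Transpose

/-! ### Two-term projective resolutions and derived functors. -/

section Resolution

open Limits

variable {C : Type*} [Category* C] [Abelian C]

/-- The complex `0 → X₁ → X₂` attached to a short complex `X₁ → X₂ → X₃`. -/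
noncomputable abbrev twoTermComplex (S : ShortComplex C) : ChainComplex C ℕ :=
  HomologicalComplex.double S.f (i₀ := 1) (i₁ := 0) (c := ComplexShape.down ℕ) rfl

noncomputable abbrev twoTermIso₁ (S : ShortComplex C) : (twoTermComplex S).X 1 ≅ S.X₁ :=
  HomologicalComplex.doubleXIso₀ S.f (i₀ := 1) (i₁ := 0) (c := ComplexShape.down ℕ) rfl

noncomputable abbrev twoTermIso₀ (S : ShortComplex C) : (twoTermComplex S).X 0 ≅ S.X₂ :=
  HomologicalComplex.doubleXIso₁ S.f (i₀ := 1) (i₁ := 0) (c := ComplexShape.down ℕ) rfl one_ne_zero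

theorem twoTermComplex_d (S : ShortComplex C) :
    (twoTermComplex S).d 1 0 = (twoTermIso₁ S).hom ≫ S.f ≫ (twoTermIso₀ S).inv :=
  HomologicalComplex.double_d S.f _ one_ne_zero

theorem isZero_twoTermComplex_X (S : ShortComplex C) (n : ℕ) :
    IsZero ((twoTermComplex S).X (n + 2)) :=
  HomologicalComplex.isZero_double_X _ _ _ (by simp) (by simp)

theorem exactAt_map_twoTermComplex {D : Type*} [Category* D] [Abelian D] (F : C ⥤ D) [F.Additive]
    (S : ShortComplex C) [Mono (F.map S.f)] (n : ℕ) :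
    ((F.mapHomologicalComplex _).obj (twoTermComplex S)).ExactAt (n + 1) := by
  rw [HomologicalComplex.exactAt_iff' _ (n + 1 + 1) (n + 1) n (by simp) (by simp)]
  cases n with
  | zero =>
    rw [ShortComplex.exact_iff_mono]
    · change Mono (F.map ((twoTermComplex S).d 1 0))
      rw [twoTermComplex_d, F.map_comp, F.map_comp]
      infer_instance
    · exact (F.map_isZero (isZero_twoTermComplex_X S 0)).eq_of_src _ _
  | succ n =>
    exact ShortComplex.exact_of_isZero_X₂ _ (F.map_isZero (isZero_twoTermComplex_X S n))

theorem exactAt_twoTermComplex (S : ShortComplex C) [Mono S.f] (n : ℕ) :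
    (twoTermComplex S).ExactAt (n + 1) := by
  rw [HomologicalComplex.exactAt_iff' _ (n + 1 + 1) (n + 1) n (by simp) (by simp)]
  cases n with
  | zero =>
    rw [ShortComplex.exact_iff_mono]
    · change Mono ((twoTermComplex S).d 1 0)
      rw [twoTermComplex_d]
      infer_instance
    · exact (isZero_twoTermComplex_X S 0).eq_of_src _ _
  | succ n =>
    exact ShortComplex.exact_of_isZero_X₂ _ (isZero_twoTermComplex_X S n)

/-- A short exact sequence with projective first and second term is a projective resolution. -/
noncomputable def projectiveResolutionOfShortExact {S : ShortComplex C} (hS : S.ShortExact)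
    [Projective S.X₁] [Projective S.X₂] : ProjectiveResolution S.X₃ where
  complex := twoTermComplex S
  projective n := by
    obtain _ | _ | n := n
    · exact Projective.of_iso (twoTermIso₀ S).symm ‹_›
    · exact Projective.of_iso (twoTermIso₁ S).symm ‹_›
    · exact (isZero_twoTermComplex_X S n).projective
  π := (ChainComplex.toSingle₀Equiv _ _).symm ⟨(twoTermIso₀ S).hom ≫ S.g, by
    rw [twoTermComplex_d]
    simp⟩
  quasiIso := ⟨fun n => by
    have := hS.mono_f
    have h12 : (twoTermIso₁ S).hom ≫ S.f = (twoTermComplex S).d 1 0 ≫ (twoTermIso₀ S).hom := by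
      rw [twoTermComplex_d]
      simp
    cases n with
    | zero =>
      rw [ChainComplex.quasiIsoAt₀_iff, ShortComplex.quasiIso_iff_of_zeros']
      · refine (ShortComplex.exact_and_epi_g_iff_of_iso (S₂ := S) ?_).2 ⟨hS.exact, hS.epi_g⟩
        exact ShortComplex.isoMk (twoTermIso₁ S) (twoTermIso₀ S) (Iso.refl _)
          h12 (by
            simp only [ChainComplex.toSingle₀Equiv_symm_apply_f_zero,
              HomologicalComplex.shortComplexFunctor'_map_τ₂]
            exact (Category.comp_id ((twoTermIso₀ S).hom ≫ S.g)).symm)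
      · exact (twoTermComplex S).shape 0 0 (by simp)
      all_goals rfl
    | succ n =>
      rw [quasiIsoAt_iff_exactAt']
      · exact exactAt_twoTermComplex S n
      · exact ChainComplex.exactAt_succ_single_obj _ _⟩

theorem isZero_leftDerived_of_mono {D : Type*} [Category* D] [Abelian D]
    [HasProjectiveResolutions C] (F : C ⥤ D) [F.Additive]
    {S : ShortComplex C} (hS : S.ShortExact) [Projective S.X₁] [Projective S.X₂]
    [Mono (F.map S.f)] (n : ℕ) : IsZero ((F.leftDerived (n + 1)).obj S.X₃) := by
  refine IsZero.of_iso ?_ ((projectiveResolutionOfShortExact hS).isoLeftDerivedObj F (n + 1))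
  exact (HomologicalComplex.exactAt_iff_isZero_homology _ _).1 (exactAt_map_twoTermComplex F S n)

end Resolution

/-! ### Tor and projective dimension from a two-term resolution. -/

section Tor

variable {R : Type u} [CommRing R] {M P Q N : Type u} [AddCommGroup M] [Module R M]
  [AddCommGroup P] [Module R P] [AddCommGroup Q] [Module R Q] [AddCommGroup N] [Module R N]
  [Module.Projective R P] [Module.Projective R Q] {f : P →ₗ[R] Q} {g : Q →ₗ[R] N}

/-- The short complex of modules attached to an exact pair of linear maps. -/
abbrev exactShortComplex (hfg : Function.Exact f g) : ShortComplex (ModuleCat.{u} R) :=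
  ShortComplex.mk (ModuleCat.ofHom f) (ModuleCat.ofHom g) (by
    ext x
    exact hfg.apply_apply_eq_zero x)

omit [Module.Projective R P] [Module.Projective R Q] in
theorem shortExact_exactShortComplex (hf : Function.Injective f) (hfg : Function.Exact f g)
    (hg : Function.Surjective g) : (exactShortComplex hfg).ShortExact :=
  ModuleCat.shortComplex_shortExact _ hfg hf hg

theorem isZero_Tor_of_injective_lTensor (hf : Function.Injective f) (hfg : Function.Exact f g)
    (hg : Function.Surjective g) (hM : Function.Injective (f.lTensor M)) {i : ℕ} (hi : 1 ≤ i) :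
    Limits.IsZero (((Tor (ModuleCat.{u} R) i).obj (ModuleCat.of R M)).obj (ModuleCat.of R N)) := by
  obtain ⟨i, rfl⟩ := Nat.exists_eq_add_of_le' hi
  have : Projective (exactShortComplex hfg).X₁ := (IsProjective.iff_projective P).1 ‹_›
  have : Projective (exactShortComplex hfg).X₂ := (IsProjective.iff_projective Q).1 ‹_›
  have : Mono (((MonoidalCategory.tensoringLeft (ModuleCat.{u} R)).obj (ModuleCat.of R M)).map
      (exactShortComplex hfg).f) := (ModuleCat.mono_iff_injective _).2 hM
  exact isZero_leftDerived_of_mono _ (shortExact_exactShortComplex hf hfg hg) i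

theorem projectiveDimension_eq_one (hf : Function.Injective f) (hfg : Function.Exact f g)
    (hg : Function.Surjective g) (hN : ¬ Module.Projective R N) :
    projectiveDimension (ModuleCat.of R N) = 1 := by
  have : Projective (exactShortComplex hfg).X₁ := (IsProjective.iff_projective P).1 ‹_›
  have : Projective (exactShortComplex hfg).X₂ := (IsProjective.iff_projective Q).1 ‹_›
  refine le_antisymm ?_ ?_
  · refine (projectiveDimension_le_iff _ 1).2 ?_
    exact (shortExact_exactShortComplex hf hfg hg).hasProjectiveDimensionLT_X₃ 1 inferInstance
      inferInstance
  · refine (projectiveDimension_ge_iff _ 1).2 fun h => hN ?_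
    have : Projective (ModuleCat.of R N) := projective_iff_hasProjectiveDimensionLT_one.2 h
    exact (IsProjective.iff_projective N).2 this

end Tor

/-! ### The Koszul complex on x, z, w and the model transpose. -/

section Koszul

open Module

variable {R : Type*} [CommRing R]

/-- The elementwise form of weak regularity of a pair. -/
theorem exists_of_isWeaklyRegular_pair {M : Type*} [AddCommGroup M] [Module R M] {r s : R}
    {t : List R} (h : RingTheory.Sequence.IsWeaklyRegular M (r :: s :: t)) {a b : M}
    (hab : s • a = r • b) : ∃ c, a = r • c := by
  rw [RingTheory.Sequence.isWeaklyRegular_cons_iff,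
    RingTheory.Sequence.isWeaklyRegular_cons_iff] at h
  have h1 : (Submodule.Quotient.mk a : QuotSMulTop r M) = 0 := h.2.1 (by
    simp only [smul_zero]
    rw [← Submodule.Quotient.mk_smul, hab, Submodule.Quotient.mk_eq_zero]
    exact Submodule.smul_mem_pointwise_smul _ _ _ trivial)
  rw [Submodule.Quotient.mk_eq_zero] at h1
  obtain ⟨c, -, hc⟩ := (Submodule.mem_smul_pointwise_iff_exists _ _ _).1 h1
  exact ⟨c, hc.symm⟩

/-- The elementwise form of weak regularity of a triple. -/
theorem exists_of_isWeaklyRegular_triple {M : Type*} [AddCommGroup M] [Module R M] {r s q : R}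
    {t : List R} (h : RingTheory.Sequence.IsWeaklyRegular M (r :: s :: q :: t)) {a b c : M}
    (hab : q • a = r • b + s • c) : ∃ d e, a = r • d + s • e := by
  rw [RingTheory.Sequence.isWeaklyRegular_cons_iff] at h
  obtain ⟨e, he⟩ := exists_of_isWeaklyRegular_pair h.2 (a := Submodule.Quotient.mk a)
    (b := Submodule.Quotient.mk c) (by
      rw [← Submodule.Quotient.mk_smul, ← Submodule.Quotient.mk_smul, hab, Submodule.Quotient.eq,
        add_sub_cancel_right]
      exact Submodule.smul_mem_pointwise_smul _ _ _ trivial)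
  obtain ⟨e, rfl⟩ := Submodule.Quotient.mk_surjective _ e
  rw [← Submodule.Quotient.mk_smul, Submodule.Quotient.eq] at he
  obtain ⟨d, -, hd⟩ := (Submodule.mem_smul_pointwise_iff_exists _ _ _).1 he
  exact ⟨d, e, by rw [hd, sub_add_cancel]⟩

/-- The cokernel of `R → R³`, `1 ↦ (x, z, w)`. -/
abbrev koszulCokernel (x z w : R) : Type _ := (Fin 3 → R) ⧸ Submodule.span R {![x, z, w]}

/-- The dual of `R³` is `R³`. -/
noncomputable def dualFinThree : Dual R (Fin 3 → R) →ₗ[R] (Fin 3 → R) :=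
  LinearMap.pi fun i => LinearMap.applyₗ (Pi.single i 1)

/-- The row `(x, z, w) : R³ → R`. -/
noncomputable def koszulRow (x z w : R) : (Fin 3 → R) →ₗ[R] R :=
  x • LinearMap.proj 0 + z • LinearMap.proj 1 + w • LinearMap.proj 2

theorem koszulRow_apply (x z w : R) (v : Fin 3 → R) :
    koszulRow x z w v = x * v 0 + z * v 1 + w * v 2 := rfl

theorem exact_koszulRow (x z w : R) :
    Function.Exact (koszulRow x z w) (Ideal.span {x, z, w}).mkQ := by
  intro r
  rw [Submodule.mkQ_apply, Submodule.Quotient.mk_eq_zero, Ideal.mem_span_insert']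
  constructor
  · rintro ⟨a, ha⟩
    obtain ⟨b, c, hbc⟩ := Ideal.mem_span_pair.1 ha
    refine ⟨![-a, b, c], ?_⟩
    simp only [koszulRow_apply, Matrix.cons_val]
    linear_combination hbc
  · rintro ⟨v, rfl⟩
    refine ⟨-v 0, Ideal.mem_span_pair.2 ⟨v 1, v 2, ?_⟩⟩
    rw [koszulRow_apply]
    ring

theorem dualFinThree_bijective : Function.Bijective (dualFinThree (R := R)) := by
  constructor
  · intro f g h
    ext i
    exact congrFun h i
  · intro v
    refine ⟨∑ i, v i • LinearMap.proj i, ?_⟩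
    ext i
    simp [dualFinThree, Pi.single_apply]

theorem exact_dualMap_koszulRow (x z w : R) :
    Function.Exact (koszulRow x z w).dualMap
      ((Submodule.span R {![x, z, w]}).mkQ ∘ₗ dualFinThree) := by
  have key : ∀ g : Dual R R, dualFinThree ((koszulRow x z w).dualMap g) = g 1 • ![x, z, w] := by
    intro g
    have h : ∀ r, g r = r * g 1 := fun r => by
      rw [← smul_eq_mul, ← map_smul, smul_eq_mul, mul_one]
    ext i
    fin_cases i <;> simp [dualFinThree, koszulRow_apply, h x, h z, h w, mul_comm]
  intro f
  rw [LinearMap.comp_apply, Submodule.mkQ_apply, Submodule.Quotient.mk_eq_zero,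
    Submodule.mem_span_singleton]
  constructor
  · rintro ⟨a, ha⟩
    refine ⟨a • LinearMap.id, dualFinThree_bijective.1 ?_⟩
    rw [key, ← ha]
    simp
  · rintro ⟨g, rfl⟩
    exact ⟨g 1, (key g).symm⟩

section Tensor

variable (M : Type*) [AddCommGroup M] [Module R M] (x z w : R)

/-- The surjection `M³ → M ⊗ coker (x, z, w)`. -/
noncomputable def koszulProj : (Fin 3 → M) →ₗ[R] M ⊗[R] koszulCokernel x z w :=
  ∑ i, (TensorProduct.mk R M (koszulCokernel x z w)).flip (Submodule.Quotient.mk (Pi.single i 1)) ∘ₗ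
    LinearMap.proj i

variable {M}

theorem koszulProj_apply (m : Fin 3 → M) : koszulProj M x z w m =
    ∑ i, m i ⊗ₜ[R] (Submodule.Quotient.mk (Pi.single i 1) : koszulCokernel x z w) := by
  simp [koszulProj]

theorem koszulProj_smul (m : M) (v : Fin 3 → R) : koszulProj M x z w (fun i => v i • m) =
    m ⊗ₜ[R] (Submodule.Quotient.mk v : koszulCokernel x z w) := by
  rw [koszulProj_apply]
  simp_rw [TensorProduct.smul_tmul, ← TensorProduct.tmul_sum, ← Submodule.Quotient.mk_smul]
  congr 1
  simp_rw [← Submodule.mkQ_apply]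
  rw [← map_sum]
  congr 1
  ext j
  simp [Finset.sum_apply, Pi.single_apply]

theorem koszulProj_surjective : Function.Surjective (koszulProj M x z w) := by
  rw [← LinearMap.range_eq_top, eq_top_iff, ← TensorProduct.span_tmul_eq_top, Submodule.span_le]
  rintro _ ⟨m, n, rfl⟩
  obtain ⟨v, rfl⟩ := Submodule.Quotient.mk_surjective _ n
  exact ⟨_, koszulProj_smul x z w m v⟩

theorem koszulProj_eq_zero (m : M) : koszulProj M x z w ![x • m, z • m, w • m] = 0 := by
  have h : (![x • m, z • m, w • m] : Fin 3 → M) = fun i => (![x, z, w] : Fin 3 → R) i • m := by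
    ext i
    fin_cases i <;> rfl
  rw [h, koszulProj_smul, (Submodule.Quotient.mk_eq_zero _).2 (Submodule.mem_span_singleton_self _),
    TensorProduct.tmul_zero]

variable (M)

/-- The second Koszul map `M³ → M³`. -/
noncomputable def koszulMap : (Fin 3 → M) →ₗ[R] (Fin 3 → M) :=
  LinearMap.pi ![x • LinearMap.proj 1 - z • LinearMap.proj 0,
    x • LinearMap.proj 2 - w • LinearMap.proj 0, z • LinearMap.proj 2 - w • LinearMap.proj 1]

/-- The last Koszul map `M³ → M`. -/
noncomputable def koszulLast : (Fin 3 → M) →ₗ[R] M :=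
  x • LinearMap.proj 2 - z • LinearMap.proj 1 + w • LinearMap.proj 0

variable {M}

theorem koszulMap_apply (m : Fin 3 → M) : koszulMap M x z w m =
    ![x • m 1 - z • m 0, x • m 2 - w • m 0, z • m 2 - w • m 1] := by
  ext i
  fin_cases i <;> rfl

theorem koszulLast_apply (m : Fin 3 → M) :
    koszulLast M x z w m = x • m 2 - z • m 1 + w • m 0 := rfl

variable (M)

theorem exists_koszulMap_factor : ∃ κ : M ⊗[R] koszulCokernel x z w →ₗ[R] (Fin 3 → M),
    ∀ m, κ (koszulProj M x z w m) = koszulMap M x z w m := by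
  let κ₀ : koszulCokernel x z w →ₗ[R] (Fin 3 → R) :=
    (Submodule.span R {![x, z, w]}).liftQ (koszulMap R x z w) (by
      rw [Submodule.span_le, Set.singleton_subset_iff]
      simp only [SetLike.mem_coe, LinearMap.mem_ker, koszulMap_apply]
      ext i
      fin_cases i <;> simp [mul_comm])
  have hκ₀ : ∀ v, κ₀ (Submodule.Quotient.mk v) = koszulMap R x z w v := fun v => rfl
  refine ⟨(TensorProduct.piScalarRight R R M (Fin 3)).toLinearMap ∘ₗ κ₀.lTensor M, fun m => ?_⟩
  rw [koszulProj_apply]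
  simp only [map_sum, LinearMap.comp_apply, LinearMap.lTensor_tmul, hκ₀, koszulMap_apply]
  ext j
  fin_cases j <;> simp [Fin.sum_univ_three, Pi.single_apply, sub_eq_add_neg] <;> abel

variable {M} {x z w}

/-- Nothing is asked of x, so this also applies to M = R, where x is a zero divisor. -/
theorem mem_ker_koszulMap (hz : IsSMulRegular M z)
    (hw : ∀ a b : M, w • a = z • b → ∃ c, a = z • c) {m : Fin 3 → M}
    (hm : koszulMap M x z w m = 0) : ∃ t : M, m = ![x • t, z • t, w • t] := by
  rw [koszulMap_apply] at hm
  have h0 : x • m 1 - z • m 0 = 0 := congrFun hm 0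
  have h1 : x • m 2 - w • m 0 = 0 := congrFun hm 1
  have h2 : z • m 2 - w • m 1 = 0 := congrFun hm 2
  obtain ⟨t, ht⟩ := hw (m 1) (m 2) (sub_eq_zero.1 h2).symm
  refine ⟨t, ?_⟩
  ext i
  fin_cases i
  · refine hz ?_
    rw [ht] at h0
    simpa [smul_comm z x] using (sub_eq_zero.1 h0).symm
  · exact ht
  · refine hz ?_
    rw [ht] at h2
    simpa [smul_comm z w] using sub_eq_zero.1 h2

theorem koszulFactor_injective (hz : IsSMulRegular M z)
    (hw : ∀ a b : M, w • a = z • b → ∃ c, a = z • c)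
    {κ : M ⊗[R] koszulCokernel x z w →ₗ[R] (Fin 3 → M)}
    (hκ : ∀ m, κ (koszulProj M x z w m) = koszulMap M x z w m) : Function.Injective κ := by
  refine (injective_iff_map_eq_zero _).2 fun t ht => ?_
  obtain ⟨m, rfl⟩ := koszulProj_surjective x z w t
  rw [hκ] at ht
  obtain ⟨t, rfl⟩ := mem_ker_koszulMap hz hw ht
  exact koszulProj_eq_zero x z w t

theorem exact_koszulFactor (hx : IsSMulRegular M x)
    (hz : ∀ a b : M, z • a = x • b → ∃ c, a = x • c)
    (hw : ∀ a b c : M, w • a = x • b + z • c → ∃ d e, a = x • d + z • e)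
    {κ : M ⊗[R] koszulCokernel x z w →ₗ[R] (Fin 3 → M)}
    (hκ : ∀ m, κ (koszulProj M x z w m) = koszulMap M x z w m) :
    Function.Exact κ (koszulLast M x z w) := by
  intro m
  constructor
  · intro hm
    rw [koszulLast_apply] at hm
    obtain ⟨b, a, h0⟩ := hw (m 0) (-m 2) (m 1) (by
      rw [← sub_eq_zero, ← hm, smul_neg]
      abel)
    obtain ⟨c, h1⟩ := hz (m 1 - w • a) (m 2 + w • b) (by
      rw [h0] at hm
      rw [← sub_eq_zero, ← neg_eq_zero, ← hm]
      simp only [smul_sub, smul_add, smul_comm w x, smul_comm w z]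
      abel)
    have h2 : m 2 = z • c - w • b := by
      refine hx ?_
      have h1' : m 1 = x • c + w • a := by rw [← h1]; abel
      rw [h0, h1'] at hm
      rw [← sub_eq_zero]
      simp only
      rw [← hm]
      simp only [smul_sub, smul_add, smul_comm w x, smul_comm w z, smul_comm z x]
      abel
    refine ⟨koszulProj M x z w ![-a, b, c], ?_⟩
    rw [hκ, koszulMap_apply]
    ext i
    fin_cases i
    · simp [h0]
    · simp [sub_eq_iff_eq_add.1 h1]
    · simp [h2]
  · rintro ⟨t, rfl⟩
    obtain ⟨m, rfl⟩ := koszulProj_surjective x z w t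
    rw [hκ, koszulMap_apply, koszulLast_apply]
    simp only [Matrix.cons_val, smul_sub, smul_comm w x, smul_comm w z, smul_comm z x]
    abel

theorem exists_koszul_homotopy {κ : M ⊗[R] koszulCokernel x z w →ₗ[R] (Fin 3 → M)}
    (hκ : ∀ m, κ (koszulProj M x z w m) = koszulMap M x z w m) :
    ∃ h : (Fin 3 → M) →ₗ[R] M ⊗[R] koszulCokernel x z w, ∀ t, h (κ t) = z • t := by
  -- This is the Koszul contraction against z: composed with the Koszul map it sends m to z • m −
  -- m₁(x, z, w), and the second term is zero in the cokernel.
  refine ⟨koszulProj M x z w ∘ₗ LinearMap.pi ![-LinearMap.proj 0, 0, LinearMap.proj 2], fun t => ?_⟩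
  obtain ⟨m, rfl⟩ := koszulProj_surjective x z w t
  rw [hκ, koszulMap_apply, LinearMap.comp_apply, ← map_smul, ← sub_eq_zero, ← map_sub,
    ← neg_eq_zero, ← map_neg, ← koszulProj_eq_zero x z w (m 1)]
  congr 1
  ext i
  fin_cases i <;> simp

theorem isReflexive_tensor_koszulCokernel (hM : IsReflexive R M)
    (h : RingTheory.Sequence.IsWeaklyRegular M [x, z, w])
    (h' : RingTheory.Sequence.IsWeaklyRegular M [z, w]) (hz : IsSMulRegular R z) :
    IsReflexive R (M ⊗[R] koszulCokernel x z w) := by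
  obtain ⟨κ, hκ⟩ := exists_koszulMap_factor M x z w
  obtain ⟨s, hs⟩ := exists_koszul_homotopy hκ
  have hx := ((RingTheory.Sequence.isWeaklyRegular_cons_iff _ _ _).1 h).1
  have hz' := ((RingTheory.Sequence.isWeaklyRegular_cons_iff _ _ _).1 h').1
  exact isReflexive_of_exact
    (koszulFactor_injective hz' (fun a b => exists_of_isWeaklyRegular_pair h') hκ)
    (exact_koszulFactor hx (fun a b => exists_of_isWeaklyRegular_pair h)
      (fun a b c => exists_of_isWeaklyRegular_triple h) hκ)
    (isReflexive_pi hM 3) (bijective_dual_eval R M).1 hz s hs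

end Tensor

variable {x y z w : R}

theorem isTorsionFree_koszulCokernel (h : RingTheory.Sequence.IsWeaklyRegular R [z, w]) :
    IsTorsionFree R (koszulCokernel x z w) := by
  obtain ⟨κ, hκ⟩ := exists_koszulMap_factor R x z w
  have hz := ((RingTheory.Sequence.isWeaklyRegular_cons_iff _ _ _).1 h).1
  have hinj := koszulFactor_injective hz (fun a b => exists_of_isWeaklyRegular_pair h) hκ
  exact (hinj.comp (TensorProduct.lid R (koszulCokernel x z w)).symm.injective).moduleIsTorsionFree
    (κ ∘ₗ (TensorProduct.lid R (koszulCokernel x z w)).symm.toLinearMap) fun c m => map_smul _ c m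

theorem not_isReflexive_koszulCokernel (hxy : x * y = 0)
    (h : RingTheory.Sequence.IsWeaklyRegular R [z, w]) (hy : y ∉ Ideal.span {z, w}) :
    ¬ IsReflexive R (koszulCokernel x z w) := by
  intro hrefl
  have hz := ((RingTheory.Sequence.isWeaklyRegular_cons_iff _ _ _).1 h).1
  let e : Fin 3 → koszulCokernel x z w := fun i => Submodule.Quotient.mk (Pi.single i 1)
  have hmk : ∀ (g : Dual R (koszulCokernel x z w)) (v : Fin 3 → R),
      g (Submodule.Quotient.mk v) = v 0 * g (e 0) + v 1 * g (e 1) + v 2 * g (e 2) := by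
    intro g v
    have hv : (Submodule.Quotient.mk v : koszulCokernel x z w) =
        v 0 • e 0 + v 1 • e 1 + v 2 • e 2 := by
      simp only [e, ← Submodule.Quotient.mk_smul, ← Submodule.Quotient.mk_add]
      congr 1
      ext i
      fin_cases i <;> simp
    simp [hv]
  -- A functional g satisfies x g₀ + z g₁ + w g₂ = 0. Multiplying by y removes x, and regularity of
  -- z, w gives z ∣ y g₂. The quotient τ(g) = y g₂ / z is the functional on K* that is no
  -- evaluation.
  have hex : ∀ g : Dual R (koszulCokernel x z w), ∃ t, z * t = y * g (e 2) := by
    intro g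
    have h0 : g (Submodule.Quotient.mk ![x, z, w]) = 0 := by
      rw [(Submodule.Quotient.mk_eq_zero _).2 (Submodule.mem_span_singleton_self _), map_zero]
    rw [hmk] at h0
    simp only [Matrix.cons_val] at h0
    obtain ⟨c, hc⟩ := exists_of_isWeaklyRegular_pair h (a := y * g (e 2)) (b := - (y * g (e 1))) (by
      simp only [smul_eq_mul]
      linear_combination y * h0 - g (e 0) * hxy)
    exact ⟨c, hc.symm⟩
  choose τ hτ using hex
  let Φ : Dual R (Dual R (koszulCokernel x z w)) :=
    { toFun := τ
      map_add' := fun g g' => hz (by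
        simp only [smul_eq_mul, mul_add, hτ]
        simp [mul_add])
      map_smul' := fun c g => hz (by
        simp only [smul_eq_mul, hτ, RingHom.id_apply]
        rw [mul_left_comm, hτ]
        simp [mul_left_comm]) }
  obtain ⟨n, hn⟩ := (bijective_dual_eval R (koszulCokernel x z w)).2 Φ
  obtain ⟨v, rfl⟩ := Submodule.Quotient.mk_surjective _ n
  -- On the test functional (0, −w, z) every evaluation takes a value in (z, w), whereas τ takes the
  -- value y.
  let g : Dual R (koszulCokernel x z w) := (Submodule.span R {![x, z, w]}).liftQ
    (z • LinearMap.proj 2 - w • LinearMap.proj 1) (by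
      rw [Submodule.span_le, Set.singleton_subset_iff]
      simp [mul_comm])
  have hg : ∀ v, g (Submodule.Quotient.mk v) = z * v 2 - w * v 1 := fun v => rfl
  have h1 : τ g = g (Submodule.Quotient.mk v) := (LinearMap.congr_fun hn g).symm
  have h2 : g (e 2) = z := by simp [e, hg]
  have h3 : τ g = y := hz (by
    simp only [smul_eq_mul, hτ, h2]
    ring)
  apply hy
  rw [← h3, h1, hg]
  exact Ideal.mem_span_pair.2 ⟨v 2, - v 1, by ring⟩

end Koszul

/-! ### Power series rings are regular and complete, with prime ideals generated by variables. -/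

section PowerSeries

open MvPowerSeries

variable {σ : Type*} {k : Type*} [Field k]

theorem mem_span_X_of_coeff [DecidableEq σ] (s : Finset σ) (f : MvPowerSeries σ k)
    (h : ∀ m : σ →₀ ℕ, (∀ i ∈ s, m i = 0) → coeff m f = 0) :
    f ∈ Ideal.span (X '' (s : Set σ) : Set (MvPowerSeries σ k)) := by
  induction s using Finset.induction_on generalizing f with
  | empty =>
    have : f = 0 := by
      ext m
      simpa using h m (by simp)
    simp [this]
  | insert i s hi ih =>
    -- The part of f free of the variable i; the rest is divisible by that variable.
    let g : MvPowerSeries σ k := fun m => if m i = 0 then coeff m f else 0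
    have hg : ∀ m, coeff m g = if m i = 0 then coeff m f else 0 := fun m => rfl
    have h1 : g ∈ Ideal.span (X '' (s : Set σ) : Set (MvPowerSeries σ k)) := by
      refine ih g fun m hm => ?_
      rw [hg]
      split_ifs with h0
      · exact h m (by simpa [h0] using hm)
      · rfl
    obtain ⟨c, hc⟩ : X i ∣ f - g := by
      rw [X_dvd_iff]
      intro m hm
      simp [hg, hm]
    rw [← sub_add_cancel f g, hc]
    refine add_mem (Ideal.mul_mem_right _ _ (Ideal.subset_span ⟨i, by simp, rfl⟩))
      (Ideal.span_mono (Set.image_mono ?_) h1)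
    simp

/-- This presents the quotient by the variables in s inside a power series ring in the others, a
domain, whence primeness. -/
theorem ker_killCompl [DecidableEq σ] (s : Finset σ) :
    RingHom.ker (killCompl (R := k) (Function.Embedding.subtype (· ∉ s))) =
      Ideal.span (X '' (s : Set σ)) := by
  refine le_antisymm (fun f hf => mem_span_X_of_coeff s f fun m hm => ?_) ?_
  · obtain ⟨m, rfl⟩ : m ∈ Set.range (Finsupp.embDomain (Function.Embedding.subtype (· ∉ s))) := by
      rw [Finsupp.mem_range_embDomain_iff]
      intro i hi
      have : i ∉ s := fun h => by simp [hm i h] at hi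
      exact ⟨⟨i, this⟩, rfl⟩
    rw [← coeff_killCompl, (RingHom.mem_ker).1 hf]
    simp
  · rw [Ideal.span_le]
    rintro _ ⟨i, hi, rfl⟩
    exact killCompl_X_eq_zero (by simpa using hi)

instance isDomain_mvPowerSeries : IsDomain (MvPowerSeries σ k) :=
  NoZeroDivisors.to_isDomain _

theorem isPrime_span_X [DecidableEq σ] (s : Finset σ) :
    (Ideal.span (X '' (s : Set σ) : Set (MvPowerSeries σ k))).IsPrime := by
  rw [← ker_killCompl]
  exact RingHom.ker_isPrime _

theorem X_mem_span_X_iff [DecidableEq σ] (s : Finset σ) (i : σ) :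
    (X i : MvPowerSeries σ k) ∈ Ideal.span (X '' (s : Set σ) : Set (MvPowerSeries σ k)) ↔ i ∈ s := by
  refine ⟨fun h => ?_, fun h => Ideal.subset_span ⟨i, h, rfl⟩⟩
  by_contra hi
  rw [← ker_killCompl, RingHom.mem_ker] at h
  have h1 := killCompl_X (R := k) (e := Function.Embedding.subtype (· ∉ s)) ⟨i, hi⟩
  have h2 : (X (⟨i, hi⟩ : {i // i ∉ s}) : MvPowerSeries {i // i ∉ s} k) = 0 := h1.symm.trans h
  have h3 := congrArg (coeff (Finsupp.single ⟨i, hi⟩ 1)) h2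
  simp [coeff_X] at h3

theorem maximalIdeal_eq_span_X [Finite σ] :
    IsLocalRing.maximalIdeal (MvPowerSeries σ k) = Ideal.span (Set.range X) := by
  classical
  have := Fintype.ofFinite σ
  refine le_antisymm (fun f hf => ?_) ?_
  · rw [← Set.image_univ, ← Finset.coe_univ]
    refine mem_span_X_of_coeff _ f fun m hm => ?_
    obtain rfl : m = 0 := by
      ext i
      exact hm i (Finset.mem_univ i)
    rw [IsLocalRing.mem_maximalIdeal, mem_nonunits_iff, isUnit_iff_constantCoeff,
      isUnit_iff_ne_zero, not_not] at hf
    exact hf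
  · rw [Ideal.span_le]
    rintro _ ⟨i, rfl⟩
    simp [isUnit_iff_constantCoeff]

theorem card_le_height_span_X [DecidableEq σ] (s : Finset σ) :
    (s.card : ℕ∞) ≤ (Ideal.span (X '' (s : Set σ) : Set (MvPowerSeries σ k))).height := by
  induction s using Finset.induction_on with
  | empty => simp
  | insert i s hi ih =>
    have h1 := isPrime_span_X (k := k) s
    have h2 := isPrime_span_X (k := k) (insert i s)
    rw [Finset.card_insert_of_notMem hi]
    rw [Nat.cast_add, Nat.cast_one]
    have hlt : Ideal.span (X '' (s : Set σ) : Set (MvPowerSeries σ k)) <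
        Ideal.span (X '' ((insert i s : Finset σ) : Set σ)) := by
      refine lt_of_le_of_ne (Ideal.span_mono (Set.image_mono (by simp))) fun h => hi ?_
      rw [← X_mem_span_X_iff (k := k), h, X_mem_span_X_iff]
      exact Finset.mem_insert_self i s
    exact (add_le_add ih le_rfl).trans (Ideal.height_add_one_le_of_lt_of_isPrime hlt)

theorem card_le_ringKrullDim [Fintype σ] :
    (Fintype.card σ : WithBot ℕ∞) ≤ ringKrullDim (MvPowerSeries σ k) := by
  classical
  have := isPrime_span_X (k := k) (Finset.univ : Finset σ)
  exact (WithBot.coe_le_coe.2 (card_le_height_span_X (k := k) (Finset.univ : Finset σ))).trans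
    Ideal.height_le_ringKrullDim_of_isPrime

theorem spanFinrank_maximalIdeal_le [Fintype σ] :
    (IsLocalRing.maximalIdeal (MvPowerSeries σ k)).spanFinrank ≤ Fintype.card σ := by
  rw [maximalIdeal_eq_span_X]
  refine (Submodule.spanFinrank_span_le_ncard_of_finite (Set.finite_range _)).trans ?_
  rw [← Set.image_univ, ← Nat.card_eq_fintype_card, ← Set.ncard_univ]
  exact Set.ncard_image_le Set.finite_univ

instance isRegularLocalRing_mvPowerSeries [Finite σ] :
    IsRegularLocalRing (MvPowerSeries σ k) := by
  have := Fintype.ofFinite σ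
  exact .of_spanFinrank_maximalIdeal_le _
    (le_trans (by exact_mod_cast spanFinrank_maximalIdeal_le) card_le_ringKrullDim)

theorem ringKrullDim_mvPowerSeries [Fintype σ] :
    ringKrullDim (MvPowerSeries σ k) = Fintype.card σ := by
  refine le_antisymm ?_ card_le_ringKrullDim
  rw [← IsRegularLocalRing.spanFinrank_maximalIdeal]
  exact_mod_cast spanFinrank_maximalIdeal_le

instance isAdicComplete_maximalIdeal_mvPowerSeries [Finite σ] :
    IsAdicComplete (IsLocalRing.maximalIdeal (MvPowerSeries σ k)) (MvPowerSeries σ k) := by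
  rw [maximalIdeal_eq_span_X]
  infer_instance

end PowerSeries

/-! ### Completeness of quotient rings. -/

section Quotient

theorem isPrecomplete_of_surjective {R S : Type*} [CommRing R] [CommRing S] (f : R →+* S)
    (hf : Function.Surjective f) (I : Ideal R) [IsPrecomplete I R] : IsPrecomplete (I.map f) S := by
  let _ := f.toAlgebra
  change IsPrecomplete (I.map (algebraMap R S)) S
  rw [IsPrecomplete.map_algebraMap_iff, ← AdicCompletion.of_surjective_iff]
  intro x
  obtain ⟨y, rfl⟩ := AdicCompletion.map_surjective I (f := Algebra.linearMap R S) hf x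
  obtain ⟨z, rfl⟩ := AdicCompletion.of_surjective I R y
  exact ⟨f z, (AdicCompletion.map_of I (Algebra.linearMap R S) z).symm⟩

end Quotient

/-! ### The ring R: ideals of variables, regular sequences, dimension. -/

section Ring

variable (k : Type u) [Field k]

/-- The ideal of `R` generated by the variables with index in `s`. -/
noncomputable def varIdeal (s : Finset (Fin 5)) : Ideal (R k) := Ideal.span (var k '' (s : Set (Fin 5)))

theorem ker_toR : RingHom.ker (toR k) = Ideal.span {MvPowerSeries.X 0 * MvPowerSeries.X 1} :=
  Ideal.mk_ker

theorem var_zero_mul_var_one : var k 0 * var k 1 = 0 := by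
  rw [var, var, ← map_mul, ← RingHom.mem_ker, ker_toR]
  exact Ideal.mem_span_singleton_self _

theorem varIdeal_eq_map (s : Finset (Fin 5)) : varIdeal k s =
    (Ideal.span (MvPowerSeries.X '' (s : Set (Fin 5)))).map (toR k) := by
  rw [Ideal.map_span, Set.image_image]
  rfl

theorem ker_toR_le {s : Finset (Fin 5)} (hs : 0 ∈ s ∨ 1 ∈ s) :
    RingHom.ker (toR k) ≤ Ideal.span (MvPowerSeries.X '' (s : Set (Fin 5))) := by
  rw [ker_toR, Ideal.span_singleton_le_iff_mem]
  rcases hs with hs | hs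
  · exact Ideal.mul_mem_right _ _ (Ideal.subset_span ⟨0, hs, rfl⟩)
  · exact Ideal.mul_mem_left _ _ (Ideal.subset_span ⟨1, hs, rfl⟩)

theorem isPrime_varIdeal {s : Finset (Fin 5)} (hs : 0 ∈ s ∨ 1 ∈ s) : (varIdeal k s).IsPrime := by
  have := isPrime_span_X (k := k) s
  rw [varIdeal_eq_map]
  exact Ideal.map_isPrime_of_surjective (toR_surjective k) (ker_toR_le k hs)

theorem var_mem_varIdeal_iff {s : Finset (Fin 5)} (hs : 0 ∈ s ∨ 1 ∈ s) (i : Fin 5) :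
    var k i ∈ varIdeal k s ↔ i ∈ s := by
  rw [varIdeal_eq_map, var, ← Ideal.mem_comap, Ideal.comap_map_of_surjective' _ (toR_surjective k),
    sup_eq_left.2 (ker_toR_le k hs), X_mem_span_X_iff]

theorem varIdeal_insert (s : Finset (Fin 5)) (i : Fin 5) :
    varIdeal k (insert i s) = Ideal.span {var k i} ⊔ varIdeal k s := by
  rw [varIdeal, varIdeal, ← Ideal.span_union, Finset.coe_insert, Set.image_insert_eq]
  rfl

/-- Write f = ax + b with b in (s). Primeness of (y, s), which omits x, puts a in (y, s), and then
xy = 0 puts ax in (s). So (s) is an intersection of two primes even when it is not itself prime. -/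
theorem mem_varIdeal_of_mem_of_mem {s : Finset (Fin 5)} (hs : 0 ∉ s) {f : R k}
    (h0 : f ∈ varIdeal k (insert 0 s)) (h1 : f ∈ varIdeal k (insert 1 s)) : f ∈ varIdeal k s := by
  rw [varIdeal_insert] at h0
  obtain ⟨_, ha, b, hb, rfl⟩ := Submodule.mem_sup.1 h0
  obtain ⟨a, rfl⟩ := Ideal.mem_span_singleton'.1 ha
  have hp := isPrime_varIdeal k (s := insert 1 s) (by simp)
  have hle : varIdeal k s ≤ varIdeal k (insert 1 s) := by
    rw [varIdeal_insert]
    exact le_sup_right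
  have h2 : a * var k 0 ∈ varIdeal k (insert 1 s) := (add_mem_cancel_right (hle hb)).1 h1
  have h3 : a ∈ varIdeal k (insert 1 s) := (hp.mem_or_mem h2).resolve_right (by
    rw [var_mem_varIdeal_iff k (by simp)]
    simpa using hs)
  rw [varIdeal_insert] at h3
  obtain ⟨_, hc, d, hd, rfl⟩ := Submodule.mem_sup.1 h3
  obtain ⟨c, rfl⟩ := Ideal.mem_span_singleton'.1 hc
  have h4 : (c * var k 1 + d) * var k 0 = d * var k 0 := by
    linear_combination c * var_zero_mul_var_one k
  rw [h4]
  exact add_mem (Ideal.mul_mem_right _ _ hd) hb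

theorem mem_varIdeal_of_var_mul_mem {s : Finset (Fin 5)} (hs : 0 ∉ s) {i : Fin 5}
    (hi : i ∉ insert 0 (insert 1 s)) {f : R k} (h : var k i * f ∈ varIdeal k s) :
    f ∈ varIdeal k s := by
  simp only [Finset.mem_insert, not_or] at hi
  have key : ∀ j : Fin 5, (j = 0 ∨ j = 1) → f ∈ varIdeal k (insert j s) := by
    intro j hj
    have hj' : 0 ∈ insert j s ∨ 1 ∈ insert j s := by
      rcases hj with rfl | rfl <;> simp
    have hle : varIdeal k s ≤ varIdeal k (insert j s) := by
      rw [varIdeal_insert]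
      exact le_sup_right
    refine ((isPrime_varIdeal k hj').mem_or_mem (hle h)).resolve_left ?_
    rw [var_mem_varIdeal_iff k hj']
    rcases hj with rfl | rfl <;> simp [hi.1, hi.2.1, hi.2.2]
  exact mem_varIdeal_of_mem_of_mem k hs (key 0 (.inl rfl)) (key 1 (.inr rfl))

theorem varIdeal_empty : varIdeal k ∅ = ⊥ := by simp [varIdeal]

theorem varIdeal_singleton (i : Fin 5) : varIdeal k {i} = Ideal.span {var k i} := by
  simp [varIdeal]

theorem isSMulRegular_var {i : Fin 5} (hi : i ≠ 0 ∧ i ≠ 1) : IsSMulRegular (R k) (var k i) := by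
  refine isSMulRegular_iff_right_eq_zero_of_smul.2 fun f hf => ?_
  have := mem_varIdeal_of_var_mul_mem k (s := ∅) (by simp) (i := i) (f := f) (by simp [hi])
    (by rw [varIdeal_empty]; exact hf)
  rwa [varIdeal_empty] at this

open scoped Pointwise in
theorem isWeaklyRegular_var_two_var_three :
    RingTheory.Sequence.IsWeaklyRegular (R k) [var k 2, var k 3] := by
  rw [RingTheory.Sequence.isWeaklyRegular_cons_iff,
    RingTheory.Sequence.isWeaklyRegular_singleton_iff]
  refine ⟨isSMulRegular_var k (by decide), isSMulRegular_iff_right_eq_zero_of_smul.2 ?_⟩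
  intro f hf
  obtain ⟨f, rfl⟩ := Submodule.Quotient.mk_surjective _ f
  have hmem : ∀ a : R k, a ∈ var k 2 • (⊤ : Submodule (R k) (R k)) ↔ a ∈ varIdeal k {2} := by
    intro a
    rw [varIdeal_singleton, ← Submodule.ideal_span_singleton_smul]
    simp
  rw [← Submodule.Quotient.mk_smul, Submodule.Quotient.mk_eq_zero, hmem] at hf
  rw [Submodule.Quotient.mk_eq_zero, hmem]
  exact mem_varIdeal_of_var_mul_mem k (by decide) (by decide) hf

theorem var_mem_maximalIdeal (i : Fin 5) : var k i ∈ IsLocalRing.maximalIdeal (R k) := by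
  rw [IsLocalRing.mem_maximalIdeal, mem_nonunits_iff]
  intro h
  have := h.map (evalZero k)
  rw [evalZero_var] at this
  exact not_isUnit_zero this

theorem var_zero_mul_eq_zero_iff (a : R k) : var k 0 * a = 0 ↔ ∃ b, a = var k 1 * b := by
  constructor
  · intro h
    have hp := isPrime_varIdeal k (s := {1}) (by simp)
    have h1 : a ∈ varIdeal k {1} :=
      (hp.mem_or_mem (x := var k 0) (by rw [h]; exact zero_mem _)).resolve_left (by
        rw [var_mem_varIdeal_iff k (by simp)]
        decide)
    rw [varIdeal_singleton] at h1
    exact Ideal.mem_span_singleton.1 h1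
  · rintro ⟨b, rfl⟩
    rw [← mul_assoc, var_zero_mul_var_one, zero_mul]

theorem var_one_mul_eq_zero_iff (a : R k) : var k 1 * a = 0 ↔ ∃ b, a = var k 0 * b := by
  constructor
  · intro h
    have hp := isPrime_varIdeal k (s := {0}) (by simp)
    have h1 : a ∈ varIdeal k {0} :=
      (hp.mem_or_mem (x := var k 1) (by rw [h]; exact zero_mem _)).resolve_left (by
        rw [var_mem_varIdeal_iff k (by simp)]
        decide)
    rw [varIdeal_singleton] at h1
    exact Ideal.mem_span_singleton.1 h1
  · rintro ⟨b, rfl⟩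
    rw [mul_left_comm, ← mul_assoc, var_zero_mul_var_one, zero_mul]

theorem isReflexive_A : Module.IsReflexive (R k) (A k) :=
  isReflexive_quotient_span_singleton (var_one_mul_eq_zero_iff k) (var_zero_mul_eq_zero_iff k)

theorem mk_mem_smul_top_iff {R : Type*} [CommRing R] (I J : Ideal R) (a : R) :
    (Ideal.Quotient.mk I a) ∈ (J • ⊤ : Submodule R (R ⧸ I)) ↔ a ∈ I ⊔ J := by
  have h1 : (J • ⊤ : Submodule R (R ⧸ I)) = Submodule.map I.mkQ J := by
    conv_rhs => rw [← mul_one J, Ideal.one_eq_top, ← smul_eq_mul, Submodule.map_smul'',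
      Submodule.map_top, Submodule.range_mkQ]
  have h2 : Submodule.comap I.mkQ (Submodule.map I.mkQ J) = J ⊔ I := by
    rw [Submodule.comap_map_eq, Submodule.ker_mkQ]
  rw [h1, sup_comm, ← h2]
  rfl

/-- Modulo y and any set of variables R is a domain, in which each remaining variable is nonzero. -/
theorem isWeaklyRegular_map_var {l : List (Fin 5)} (hl : l.Nodup) (h1 : 1 ∉ l) :
    RingTheory.Sequence.IsWeaklyRegular (A k) (l.map (var k)) := by
  refine (RingTheory.Sequence.isWeaklyRegular_iff _ _).2 fun i hi => ?_
  have hi' : i < l.length := by simpa using hi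
  have hideal : Ideal.span {var k 1} ⊔ Ideal.ofList ((l.map (var k)).take i) =
      varIdeal k (insert 1 (l.take i).toFinset) := by
    rw [varIdeal_insert, ← List.map_take]
    congr 1
    refine congrArg Ideal.span ?_
    ext a
    simp [-List.map_take]
  refine isSMulRegular_iff_right_eq_zero_of_smul.2 fun f hf => ?_
  obtain ⟨f, rfl⟩ := Submodule.Quotient.mk_surjective _ f
  obtain ⟨f, rfl⟩ := Ideal.Quotient.mk_surjective f
  rw [Submodule.Quotient.mk_eq_zero, mk_mem_smul_top_iff, hideal]
  have hf' : Ideal.Quotient.mk (Ideal.span {var k 1}) (var k l[i] * f) ∈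
      (Ideal.ofList ((l.map (var k)).take i) • ⊤ : Submodule (R k) (A k)) := by
    rw [List.getElem_map] at hf
    exact (Submodule.Quotient.mk_eq_zero _).1 hf
  rw [mk_mem_smul_top_iff, hideal] at hf'
  refine ((isPrime_varIdeal k (by simp)).mem_or_mem hf').resolve_left ?_
  rw [var_mem_varIdeal_iff k (by simp), Finset.mem_insert, not_or]
  refine ⟨fun h => h1 (h ▸ List.getElem_mem hi'), fun h => ?_⟩
  obtain ⟨j, hj, hji⟩ := List.getElem_of_mem (List.mem_toFinset.1 h)
  rw [List.getElem_take] at hji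
  have := (hl.getElem_inj_iff).1 hji
  rw [List.length_take] at hj
  omega

theorem p_eq_varIdeal : p k = varIdeal k {0, 2, 3} := by
  rw [p, varIdeal]
  congr 1
  simp [Set.image_insert_eq]

theorem isPrime_p : (p k).IsPrime := by
  rw [p_eq_varIdeal]
  exact isPrime_varIdeal k (by simp)

theorem var_one_notMem_p : var k 1 ∉ p k := by
  rw [p_eq_varIdeal, var_mem_varIdeal_iff k (by simp)]
  decide

/-- A prime inside 𝔭 omits y, hence contains x because xy = 0. So 𝔭, though given by three
generators, has height at most two by Krull. -/
theorem p_mem_minimalPrimes : p k ∈ (Ideal.span {var k 2, var k 3}).minimalPrimes := by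
  refine ⟨⟨isPrime_p k, Ideal.span_mono (by simp)⟩, fun q hq hle => ?_⟩
  have := hq.1
  have h0 : var k 0 ∈ q := (hq.1.mem_or_mem (x := var k 0) (y := var k 1) (by
    rw [var_zero_mul_var_one]
    exact zero_mem _)).resolve_right fun h => var_one_notMem_p k (hle h)
  rw [p, Ideal.span_insert, sup_le_iff]
  exact ⟨(Ideal.span_singleton_le_iff_mem _).2 h0, hq.2⟩

theorem height_varIdeal_lt {s t : Finset (Fin 5)} (hs : 0 ∈ s ∨ 1 ∈ s) (hst : s ⊂ t) :
    (varIdeal k s).height + 1 ≤ (varIdeal k t).height := by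
  have ht : 0 ∈ t ∨ 1 ∈ t := hs.imp (fun h => hst.1 h) fun h => hst.1 h
  have := isPrime_varIdeal k hs
  have := isPrime_varIdeal k ht
  refine Ideal.height_add_one_le_of_lt_of_isPrime (lt_of_le_of_ne
    (Ideal.span_mono (Set.image_mono hst.1)) fun h => hst.2 fun i hi => ?_)
  rwa [← var_mem_varIdeal_iff k hs, h, var_mem_varIdeal_iff k ht]

theorem height_p : (p k).height = 2 := by
  refine le_antisymm ?_ ?_
  · refine (Ideal.height_le_card_of_mem_minimalPrimes_span (Set.toFinite _)
      (p_mem_minimalPrimes k)).trans ?_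
    exact_mod_cast (Set.ncard_insert_le _ _).trans (by simp)
  · rw [p_eq_varIdeal]
    have h1 := height_varIdeal_lt k (s := {0}) (t := {0, 2}) (by simp) (by decide)
    have h2 := height_varIdeal_lt k (s := {0, 2}) (t := {0, 2, 3}) (by simp) (by decide)
    refine le_trans ?_ h2
    refine le_trans ?_ (add_le_add h1 le_rfl)
    rw [add_assoc]
    exact le_add_self

theorem maximalIdeal_R : IsLocalRing.maximalIdeal (R k) =
    (IsLocalRing.maximalIdeal (MvPowerSeries (Fin 5) k)).map (toR k) := by
  symm
  have hker : RingHom.ker (toR k) ≤ IsLocalRing.maximalIdeal _ :=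
    IsLocalRing.le_maximalIdeal (RingHom.ker_ne_top _)
  rcases Ideal.map_eq_top_or_isMaximal_of_surjective (toR k) (toR_surjective k)
    (IsLocalRing.maximalIdeal.isMaximal (MvPowerSeries (Fin 5) k)) with h | h
  · have h1 := Ideal.comap_map_of_surjective' _ (toR_surjective k)
      (IsLocalRing.maximalIdeal (MvPowerSeries (Fin 5) k))
    rw [h, Ideal.comap_top, sup_eq_left.2 hker] at h1
    exact absurd h1.symm (IsLocalRing.maximalIdeal.isMaximal _).ne_top
  · exact IsLocalRing.eq_maximalIdeal h

theorem X_zero_mul_X_one_ne_zero :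
    (MvPowerSeries.X 0 * MvPowerSeries.X 1 : MvPowerSeries (Fin 5) k) ≠ 0 := by
  have h : ∀ i : Fin 5, (MvPowerSeries.X i : MvPowerSeries (Fin 5) k) ≠ 0 := fun i hi => by
    have := X_mem_span_X_iff (k := k) ∅ i
    simp [hi] at this
  exact mul_ne_zero (h 0) (h 1)

theorem ringKrullDim_R : ringKrullDim (R k) = 4 := by
  have h1 : ringKrullDim (R k) + 1 = ringKrullDim (MvPowerSeries (Fin 5) k) := by
    refine ringKrullDim_quotient_span_singleton_succ_eq_ringKrullDim ?_ ?_
    · exact isSMulRegular_iff_right_eq_zero_of_smul.2 fun f hf =>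
        (mul_eq_zero.1 hf).resolve_left (X_zero_mul_X_one_ne_zero k)
    · rw [maximalIdeal_eq_span_X]
      exact Ideal.mul_mem_right _ _ (Ideal.subset_span ⟨0, rfl⟩)
  rw [ringKrullDim_mvPowerSeries, Fintype.card_fin] at h1
  generalize ringKrullDim (R k) = d at h1
  induction d with
  | bot => simp at h1
  | coe d =>
    induction d with
    | top => exact absurd h1 (by decide)
    | coe d =>
      have h2 : ((d + 1 : ℕ) : ℕ∞) = (5 : ℕ) := WithBot.coe_injective h1
      rw [Nat.cast_inj] at h2
      obtain rfl : d = 4 := by omega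
      rfl

theorem isHypersurface_R : IsHypersurface (R k) := by
  refine ⟨inferInstance, MvPowerSeries (Fin 5) k, inferInstance, inferInstance,
    MvPowerSeries.X 0 * MvPowerSeries.X 1, inferInstance, X_zero_mul_X_one_ne_zero k, ?_, ?_⟩
  · rw [pow_two, maximalIdeal_eq_span_X]
    exact Ideal.mul_mem_mul (Ideal.subset_span ⟨0, rfl⟩) (Ideal.subset_span ⟨1, rfl⟩)
  · have h1 : IsPrecomplete (IsLocalRing.maximalIdeal (R k)) (R k) := by
      rw [maximalIdeal_R]
      exact isPrecomplete_of_surjective (toR k) (toR_surjective k) _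
    have h2 : IsAdicComplete (IsLocalRing.maximalIdeal (R k)) (R k) := { }
    exact ⟨(AdicCompletion.ofAlgEquiv (IsLocalRing.maximalIdeal (R k))).symm.toRingEquiv⟩

end Ring

/-! ### Depth of third syzygies. -/

section Syzygy

open Abelian RingTheory.Sequence

theorem isWeaklyRegular_dropLast {R M : Type*} [CommRing R] [AddCommGroup M] [Module R M]
    {rs : List R} (h : IsWeaklyRegular M rs) : IsWeaklyRegular M rs.dropLast := by
  rcases eq_or_ne rs [] with rfl | h'
  · exact h
  · rw [← List.dropLast_append_getLast h', isWeaklyRegular_append_iff] at h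
    exact h.1

theorem isWeaklyRegular_pi {R : Type u} {M : Type v} [CommRing R] [AddCommGroup M] [Module R M]
    {rs : List R} (h : IsWeaklyRegular M rs) (n : ℕ) : IsWeaklyRegular (Fin n → M) rs :=
  ((TensorProduct.piScalarRight R R M (Fin n)).isWeaklyRegular_congr rs).1
    h.isWeaklyRegular_rTensor

theorem exact_rangeRestrict {R F G H : Type*} [CommRing R] [AddCommGroup F] [Module R F]
    [AddCommGroup G] [Module R G] [AddCommGroup H] [Module R H] {f : F →ₗ[R] G} {g : G →ₗ[R] H}
    (h : Function.Exact f g) : Function.Exact f g.rangeRestrict := fun x => by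
  rw [← h x, Subtype.ext_iff]
  rfl

theorem exact_subtype_range {R F G H : Type*} [CommRing R] [AddCommGroup F] [Module R F]
    [AddCommGroup G] [Module R G] [AddCommGroup H] [Module R H] {f : F →ₗ[R] G} {g : G →ₗ[R] H}
    (h : Function.Exact f g) : Function.Exact (LinearMap.range f).subtype g := fun x => by
  rw [h x]
  simp

variable {R : Type u} [CommRing R] {M F₂ F₁ F₀ X : Type u} [AddCommGroup M] [Module R M]
  [AddCommGroup F₂] [Module R F₂] [AddCommGroup F₁] [Module R F₁] [AddCommGroup F₀] [Module R F₀]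
  [AddCommGroup X] [Module R X] {i : M →ₗ[R] F₂} {d₂ : F₂ →ₗ[R] F₁} {d₁ : F₁ →ₗ[R] F₀}
  {ε : F₀ →ₗ[R] X}

theorem isWeaklyRegular_thirdSyzygy (hi : Function.Injective i) (h₂ : Function.Exact i d₂)
    (h₁ : Function.Exact d₂ d₁) (h₀ : Function.Exact d₁ ε) (hε : Function.Surjective ε) {rs : List R}
    (hrs : rs.length ≤ 3) (hF₂ : IsWeaklyRegular F₂ rs) (hF₁ : IsWeaklyRegular F₁ rs)
    (hF₀ : IsWeaklyRegular F₀ rs) : IsWeaklyRegular M rs := by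
  have hX : IsWeaklyRegular X rs.dropLast.dropLast.dropLast := by
    -- Each of the three short exact sequences drops one element, so nothing is required of X.
    rw [List.eq_nil_of_length_eq_zero (l := rs.dropLast.dropLast.dropLast) (by simp; omega)]
    exact .nil R X
  have hZ₁ : IsWeaklyRegular (LinearMap.range d₁) rs.dropLast.dropLast :=
    isWeaklyRegular_of_exact (Submodule.subtype_injective _) (exact_subtype_range h₀) hε
      (isWeaklyRegular_dropLast (isWeaklyRegular_dropLast hF₀)) hX
  have hZ₂ : IsWeaklyRegular (LinearMap.range d₂) rs.dropLast :=
    isWeaklyRegular_of_exact (Submodule.subtype_injective _)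
      (exact_rangeRestrict (exact_subtype_range h₁)) d₁.surjective_rangeRestrict
      (isWeaklyRegular_dropLast hF₁) hZ₁
  exact isWeaklyRegular_of_exact hi (exact_rangeRestrict h₂) d₂.surjective_rangeRestrict hF₂ hZ₂

/-- Four regular elements killing X give Ext³(X, M) = 0. Shifting through the syzygies yields Hom(X,
X) = 0, contradicting the identity of X ≠ 0. -/
theorem length_le_three_of_thirdSyzygy [Nontrivial X] (hi : Function.Injective i)
    (h₂ : Function.Exact i d₂) (h₁ : Function.Exact d₂ d₁) (h₀ : Function.Exact d₁ ε)
    (hε : Function.Surjective ε)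
    (hF₂ : ∀ n < 3, Subsingleton (Ext (ModuleCat.of R X) (ModuleCat.of R F₂) n))
    (hF₁ : ∀ n < 3, Subsingleton (Ext (ModuleCat.of R X) (ModuleCat.of R F₁) n))
    (hF₀ : ∀ n < 3, Subsingleton (Ext (ModuleCat.of R X) (ModuleCat.of R F₀) n)) {rs : List R}
    (hX : ∀ r ∈ rs, r ∈ Module.annihilator R X) (hM : IsWeaklyRegular M rs) : rs.length ≤ 3 := by
  by_contra! hrs
  have h3 := subsingleton_ext_of_isWeaklyRegular (K := ModuleCat.of R X) hX hM 3 hrs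
  have h2 := subsingleton_ext_of_exact hi (exact_rangeRestrict h₂) d₂.surjective_rangeRestrict
    (hF₂ 2 (by omega)) h3
  have h1 := subsingleton_ext_of_exact (Submodule.subtype_injective _)
      (exact_rangeRestrict (exact_subtype_range h₁)) d₁.surjective_rangeRestrict
      (hF₁ 1 (by omega)) h2
  have h0 := subsingleton_ext_of_exact (Submodule.subtype_injective _) (exact_subtype_range h₀) hε
    (hF₀ 0 (by omega)) h1
  have h : Subsingleton (ModuleCat.of R X ⟶ ModuleCat.of R X) := Ext.homEquiv₀.symm.subsingleton
  obtain ⟨x, hx⟩ := exists_ne (0 : X)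
  exact hx (congrArg (fun f => f.hom x) (h.elim (𝟙 (ModuleCat.of R X)) 0))

end Syzygy

/-! ### Serre's condition and depth by comparison with dim R. -/

section Serre

open Abelian RingTheory.Sequence

variable {R : Type u} [CommRing R] [IsLocalRing R] [IsNoetherianRing R] {L : Type u}
  [AddCommGroup L] [Module R L] [Module.Finite R L] {K : ModuleCat.{u} R} [Module.Finite R K]

/-- A module on which each regular sequence of length at most `n` of a maximal Cohen-Macaulay
module is regular satisfies Serre's condition. -/
theorem satisfiesSerre_of_isWeaklyRegular {M : Type v} [AddCommGroup M] [Module R M]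
    (hK : Module.annihilator R K = IsLocalRing.maximalIdeal R) {d : ℕ} (hdim : ringKrullDim R ≤ d)
    (hL : ∀ i < d, Subsingleton (Ext K (ModuleCat.of R L) i)) {n : ℕ}
    (h : ∀ rs : List R, rs.length ≤ n → IsWeaklyRegular L rs → IsWeaklyRegular M rs) :
    SatisfiesSerre n R M := by
  intro q _
  rw [IsLocalization.AtPrime.ringKrullDim_eq_height q.asIdeal]
  -- The minimum is bounded by n, hence finite, and can serve as the length of a list.
  have hn : ((min (n : ℕ∞) q.asIdeal.height).toNat : ℕ∞) = min (n : ℕ∞) q.asIdeal.height :=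
    ENat.natCast_toNat (ne_top_of_le_ne_top (ENat.natCast_ne_top n) (min_le_left _ _))
  obtain ⟨rs, hlen, hrs, hreg⟩ := exists_isWeaklyRegular_of_le_height (M := L) hK (e := d) (c := 0)
    (n := (min (n : ℕ∞) q.asIdeal.height).toNat) hdim hL q.asIdeal
    (by rw [add_zero, hn]; exact min_le_right _ _)
  have hle : rs.length ≤ n := by
    rw [hlen, ← Nat.cast_le (α := ℕ∞), hn]
    exact min_le_left _ _
  have h1 := le_depth_localizedModule q.asIdeal hrs (h rs hle hreg)
  rw [hlen, hn] at h1
  refine le_trans ?_ (WithBot.coe_le_coe.2 h1)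
  rw [WithBot.coe_min]
  exact le_rfl

theorem depth_eq_of_isWeaklyRegular [Nontrivial L]
    (hK : Module.annihilator R K = IsLocalRing.maximalIdeal R) {d : ℕ} (hdim : ringKrullDim R = d)
    {rs : List R} (hlen : rs.length = d) (hrs : ∀ r ∈ rs, r ∈ IsLocalRing.maximalIdeal R)
    (h : IsWeaklyRegular L rs) : depth R L = d := by
  refine le_antisymm (depth_le fun ts hts hL => ?_) (hlen ▸ le_depth hrs h)
  obtain ⟨P, hP⟩ := associatedPrimes.nonempty R L
  have h1 := add_height_le_ringKrullDim_of_associatedPrime hK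
    (subsingleton_ext_of_isWeaklyRegular (K := K) (hK ▸ hts) hL) hP
  rw [hdim] at h1
  have h2 : ((ts.length : ℕ∞) + P.height : ℕ∞) ≤ (d : ℕ∞) := WithBot.coe_le_coe.1 h1
  exact_mod_cast le_self_add.trans h2

end Serre

/-! ### Dualised presentations after tensoring. -/

section Transpose

open Module

variable {R : Type u} [CommRing R]

theorem isReflexive_tensor_dual {M : Type v} [AddCommGroup M] [Module R M] (hM : IsReflexive R M)
    (n : ℕ) : IsReflexive R (M ⊗[R] Dual R (Fin n → R)) :=
  have := isReflexive_pi hM n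
  Module.equiv ((TensorProduct.piScalarRight R R M (Fin n)).symm ≪≫ₗ
    TensorProduct.congr (LinearEquiv.refl R M) (Pi.basisFun R (Fin n)).toDualEquiv)

/-- Since c kills X, the dual φ* has a left inverse up to c. This survives tensoring, and c is
regular on M ⊗ F₀* because F₀* is flat. -/
theorem injective_lTensor_dualMap {M F₁ F₀ X : Type*} [AddCommGroup M] [Module R M]
    [AddCommGroup F₁] [Module R F₁] [AddCommGroup F₀] [Module R F₀] [AddCommGroup X] [Module R X]
    [Projective R F₀] [Flat R (Dual R F₀)] {φ : F₁ →ₗ[R] F₀} {ε : F₀ →ₗ[R] X}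
    (h : Function.Exact φ ε) {c : R} (hc : ∀ x : X, c • x = 0) (hM : IsSMulRegular M c) :
    Function.Injective (φ.dualMap.lTensor M) := by
  obtain ⟨s, hs⟩ := exists_homotopy_of_presentation h hc
  have h1 : s ∘ₗ φ.dualMap = c • LinearMap.id := LinearMap.ext hs
  have h2 : IsSMulRegular (M ⊗[R] Dual R F₀) c := hM.rTensor _
  refine Function.Injective.of_comp (f := s.lTensor M) ?_
  rw [← LinearMap.coe_comp, ← LinearMap.lTensor_comp, h1, LinearMap.lTensor_smul,
    LinearMap.lTensor_id]
  exact h2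

theorem injective_dualMap {F₁ F₀ X : Type*}
    [AddCommGroup F₁] [Module R F₁] [AddCommGroup F₀] [Module R F₀] [AddCommGroup X] [Module R X]
    [Projective R F₀] {φ : F₁ →ₗ[R] F₀} {ε : F₀ →ₗ[R] X}
    (h : Function.Exact φ ε) {c : R} (hc : ∀ x : X, c • x = 0) (hR : IsSMulRegular R c) :
    Function.Injective φ.dualMap := by
  obtain ⟨s, hs⟩ := exists_homotopy_of_presentation h hc
  refine Function.Injective.of_comp (f := s) fun f g hfg => ?_
  simp only [Function.comp_apply, hs] at hfg
  ext x
  exact hR (LinearMap.congr_fun hfg x)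

end Transpose

/-! ### The modules A, M and N of the example. -/

section Example

open Abelian RingTheory.Sequence Module

variable (k : Type u) [Field k]

theorem annihilator_residueField : Module.annihilator (R k) (IsLocalRing.ResidueField (A k)) =
    IsLocalRing.maximalIdeal (R k) := by
  have hsurj : Function.Surjective (algebraMap (R k) (IsLocalRing.ResidueField (A k))) :=
    (IsLocalRing.residue_surjective (R := A k)).comp Ideal.Quotient.mk_surjective
  rw [← IsLocalRing.eq_maximalIdeal (RingHom.ker_isMaximal_of_surjective _ hsurj)]
  ext r
  rw [Module.mem_annihilator, RingHom.mem_ker]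
  refine ⟨fun h => by simpa [Algebra.smul_def] using h 1, fun h x => ?_⟩
  rw [Algebra.smul_def, h, zero_mul]

instance finite_residueField : Module.Finite (R k) (IsLocalRing.ResidueField (A k)) :=
  have hsurj : Function.Surjective (algebraMap (R k) (IsLocalRing.ResidueField (A k))) :=
    (IsLocalRing.residue_surjective (R := A k)).comp Ideal.Quotient.mk_surjective
  .of_surjective (Algebra.linearMap (R k) (IsLocalRing.ResidueField (A k))) hsurj

theorem isWeaklyRegular_A : IsWeaklyRegular (A k) ([0, 2, 3, 4].map (var k)) :=
  isWeaklyRegular_map_var k (by decide) (by decide)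

theorem subsingleton_ext_A : ∀ i < 4, Subsingleton
    (Ext (ModuleCat.of (R k) (IsLocalRing.ResidueField (A k))) (ModuleCat.of (R k) (A k)) i) :=
  subsingleton_ext_of_isWeaklyRegular (fun r hr => by
    rw [annihilator_residueField]
    obtain ⟨i, -, rfl⟩ := List.mem_map.1 hr
    exact var_mem_maximalIdeal k i) (isWeaklyRegular_A k)

theorem isMaximalCohenMacaulay_A : IsMaximalCohenMacaulay (R k) (A k) := by
  refine ⟨inferInstance, ?_⟩
  rw [depth_eq_of_isWeaklyRegular
    (K := ModuleCat.of (R k) (IsLocalRing.ResidueField (A k))) (annihilator_residueField k)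
    (d := 4) (ringKrullDim_R k) rfl (fun r hr => ?_) (isWeaklyRegular_A k), ringKrullDim_R]
  · rfl
  · obtain ⟨i, -, rfl⟩ := List.mem_map.1 hr
    exact var_mem_maximalIdeal k i

theorem satisfiesSerre_of_isWeaklyRegular_A {M : Type u} [AddCommGroup M] [Module (R k) M] {n : ℕ}
    (h : ∀ rs : List (R k), rs.length ≤ n → IsWeaklyRegular (A k) rs → IsWeaklyRegular M rs) :
    SatisfiesSerre n (R k) M :=
  satisfiesSerre_of_isWeaklyRegular (L := A k)
    (K := ModuleCat.of (R k) (IsLocalRing.ResidueField (A k))) (annihilator_residueField k)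
    (d := 4) (ringKrullDim_R k).le (subsingleton_ext_A k) h

section ThirdSyzygy

variable {k} {M : Type u} [AddCommGroup M] [Module (A k) M] [Module (R k) M]
  [IsScalarTower (R k) (A k) M]

theorem isWeaklyRegular_of_isThirdSyzygy
    (h : IsThirdSyzygy (A k) (IsLocalRing.ResidueField (A k)) M) {rs : List (R k)}
    (hrs : rs.length ≤ 3) (hA : IsWeaklyRegular (A k) rs) : IsWeaklyRegular M rs := by
  obtain ⟨a, b, c, i, d₂, d₁, ε, hi, h₂, h₁, h₀, hε⟩ := h
  exact isWeaklyRegular_thirdSyzygy (i := i.restrictScalars (R k)) (d₂ := d₂.restrictScalars (R k))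
    (d₁ := d₁.restrictScalars (R k)) (ε := ε.restrictScalars (R k)) hi h₂ h₁ h₀ hε hrs
    (isWeaklyRegular_pi hA a) (isWeaklyRegular_pi hA b) (isWeaklyRegular_pi hA c)

theorem depth_of_isThirdSyzygy
    (h : IsThirdSyzygy (A k) (IsLocalRing.ResidueField (A k)) M) : depth (R k) M = 3 := by
  have hA : IsWeaklyRegular (A k) ([2, 3, 4].map (var k)) :=
    isWeaklyRegular_map_var k (by decide) (by decide)
  refine le_antisymm (depth_le (n := 3) fun rs hrs hM => ?_)
    (le_depth (rs := [2, 3, 4].map (var k)) (fun r hr => ?_)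
      (isWeaklyRegular_of_isThirdSyzygy h le_rfl hA))
  · obtain ⟨a, b, c, i, d₂, d₁, ε, hi, h₂, h₁, h₀, hε⟩ := h
    have hext : ∀ m : ℕ, ∀ n < 3, Subsingleton (Ext (ModuleCat.of (R k)
        (IsLocalRing.ResidueField (A k))) (ModuleCat.of (R k) (Fin m → A k)) n) :=
      fun m n hn => subsingleton_ext_of_isWeaklyRegular (fun r hr => by
        rw [annihilator_residueField]
        obtain ⟨i, -, rfl⟩ := List.mem_map.1 hr
        exact var_mem_maximalIdeal k i) (isWeaklyRegular_pi hA m) n hn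
    exact length_le_three_of_thirdSyzygy (i := i.restrictScalars (R k))
      (d₂ := d₂.restrictScalars (R k)) (d₁ := d₁.restrictScalars (R k))
      (ε := ε.restrictScalars (R k)) hi h₂ h₁ h₀ hε (hext a) (hext b) (hext c)
      (fun r hr => by rw [annihilator_residueField]; exact hrs r hr) hM
  · obtain ⟨i, -, rfl⟩ := List.mem_map.1 hr
    exact var_mem_maximalIdeal k i

theorem notMem_support_of_isScalarTower (hp : (p k).IsPrime) :
    (⟨p k, hp⟩ : PrimeSpectrum (R k)) ∉ Module.support (R k) M := by
  rw [Module.notMem_support_iff']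
  refine fun m => ⟨var k 1, var_one_notMem_p k, ?_⟩
  have h0 : algebraMap (R k) (A k) (var k 1) = 0 :=
    Ideal.Quotient.eq_zero_iff_mem.2 (Ideal.mem_span_singleton_self (var k 1))
  rw [← algebraMap_smul (A k), h0, zero_smul]

theorem isReflexive_of_isThirdSyzygy
    (h : IsThirdSyzygy (A k) (IsLocalRing.ResidueField (A k)) M) : IsReflexive (R k) M := by
  obtain ⟨a, b, c, i, d₂, d₁, ε, hi, h₂, h₁, h₀, hε⟩ := h
  have ha := isReflexive_pi (isReflexive_A k) a
  have hb := isReflexive_pi (isReflexive_A k) b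
  -- The homotopy is built over A, where the middle terms are free; reflexivity is then tested over
  -- R. The scalar z serves because it kills the residue field and is regular on R.
  obtain ⟨s, hs⟩ := exists_retraction_of_exact hi h₂ h₁ h₀
    (algebraMap (R k) (A k) (var k 2)) fun x => by
      rw [algebraMap_smul]
      refine Module.mem_annihilator.1 ?_ x
      rw [annihilator_residueField]
      exact var_mem_maximalIdeal k 2
  exact isReflexive_of_exact (i := i.restrictScalars (R k)) (d := d₂.restrictScalars (R k)) hi h₂ ha
    (bijective_dual_eval (R k) (Fin b → A k)).1 (isSMulRegular_var k (i := 2) (by decide))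
    (s.restrictScalars (R k)) fun m => (hs m).trans (algebraMap_smul _ _ _)

end ThirdSyzygy

section Transpose

variable {k} {M N : Type u} [AddCommGroup M] [Module (R k) M] [AddCommGroup N] [Module (R k) N]

theorem var_smul_quotient_p (x : R k ⧸ p k) : var k 2 • x = 0 := by
  obtain ⟨r, rfl⟩ := Ideal.Quotient.mk_surjective x
  exact Ideal.Quotient.eq_zero_iff_mem.2 (Ideal.mul_mem_right _ _ (Ideal.subset_span (by simp)))

theorem projectiveDimension_of_isAuslanderTranspose
    (h : IsAuslanderTranspose (R k) (R k ⧸ p k) N) :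
    projectiveDimension (ModuleCat.of (R k) N) = 1 := by
  obtain ⟨m, n, φ, ε, π, hφ, hε, hπ, hsurj⟩ := h
  have hinj := injective_dualMap hφ var_smul_quotient_p (isSMulRegular_var k (i := 2) (by decide))
  refine projectiveDimension_eq_one hinj hπ hsurj fun hN => ?_
  have hs := surjective_of_projective_transpose hinj hπ hsurj
  have hp := isPrime_p k
  have : Subsingleton (R k ⧸ p k) := subsingleton_of_forall_eq 0 fun x => by
    obtain ⟨y, rfl⟩ := hε x
    exact (hφ y).2 (hs y)
  exact not_subsingleton _ this

theorem isZero_Tor_of_isAuslanderTranspose (h : IsAuslanderTranspose (R k) (R k ⧸ p k) N)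
    (hM : IsSMulRegular M (var k 2)) {i : ℕ} (hi : 1 ≤ i) : Limits.IsZero
      (((Tor (ModuleCat.{u} (R k)) i).obj (ModuleCat.of (R k) M)).obj (ModuleCat.of (R k) N)) := by
  obtain ⟨m, n, φ, ε, π, hφ, hε, hπ, hsurj⟩ := h
  exact isZero_Tor_of_injective_lTensor
    (injective_dualMap hφ var_smul_quotient_p (isSMulRegular_var k (i := 2) (by decide))) hπ hsurj
    (injective_lTensor_dualMap hφ var_smul_quotient_p hM) hi

variable (k) in
theorem koszulCokernelMap_surjective : Function.Surjective
    ((Submodule.span (R k) {![var k 0, var k 2, var k 3]}).mkQ ∘ₗ dualFinThree) :=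
  (Submodule.mkQ_surjective _).comp dualFinThree_bijective.2

theorem exists_retract_koszulCokernel (h : IsAuslanderTranspose (R k) (R k ⧸ p k) N) :
    ∃ (m : ℕ) (s : N →ₗ[R k] koszulCokernel (var k 0) (var k 2) (var k 3) ×
        Dual (R k) (Fin m → R k))
      (r : koszulCokernel (var k 0) (var k 2) (var k 3) × Dual (R k) (Fin m → R k) →ₗ[R k] N),
      r ∘ₗ s = LinearMap.id := by
  obtain ⟨m, n, φ, ε, π, hφ, hε, hπ, hsurj⟩ := h
  exact ⟨m, exists_retract_transpose hφ hε hπ hsurj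
    (exact_koszulRow (var k 0) (var k 2) (var k 3)) (Submodule.mkQ_surjective _)
    (exact_dualMap_koszulRow _ _ _) (koszulCokernelMap_surjective k)⟩

theorem exists_retract_of_koszulCokernel (h : IsAuslanderTranspose (R k) (R k ⧸ p k) N) :
    ∃ (s : koszulCokernel (var k 0) (var k 2) (var k 3) →ₗ[R k] N × Dual (R k) (Fin 3 → R k))
      (r : N × Dual (R k) (Fin 3 → R k) →ₗ[R k] koszulCokernel (var k 0) (var k 2) (var k 3)),
      r ∘ₗ s = LinearMap.id := by
  obtain ⟨m, n, φ, ε, π, hφ, hε, hπ, hsurj⟩ := h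
  exact exists_retract_transpose (exact_koszulRow (var k 0) (var k 2) (var k 3))
    (Submodule.mkQ_surjective _) (exact_dualMap_koszulRow _ _ _) (koszulCokernelMap_surjective k)
    hφ hε hπ hsurj

theorem isReflexive_tensor_of_isAuslanderTranspose
    (h : IsAuslanderTranspose (R k) (R k ⧸ p k) N) (hM : IsReflexive (R k) M)
    (h₁ : IsWeaklyRegular M [var k 0, var k 2, var k 3])
    (h₂ : IsWeaklyRegular M [var k 2, var k 3]) : IsReflexive (R k) (M ⊗[R k] N) := by
  obtain ⟨m, s, r, hrs⟩ := exists_retract_koszulCokernel h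
  have hK := isReflexive_tensor_koszulCokernel hM h₁ h₂ (isSMulRegular_var k (i := 2) (by decide))
  have hD := isReflexive_tensor_dual hM m
  have := Module.equiv (TensorProduct.prodRight (R k) (R k) M
    (koszulCokernel (var k 0) (var k 2) (var k 3)) (Dual (R k) (Fin m → R k))).symm
  refine IsReflexive.of_split (s.lTensor M) (r.lTensor M) ?_
  rw [← LinearMap.lTensor_comp, hrs, LinearMap.lTensor_id]

theorem isTorsionFree_of_isAuslanderTranspose
    (h : IsAuslanderTranspose (R k) (R k ⧸ p k) N) : IsTorsionFree (R k) N := by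
  obtain ⟨m, s, r, hrs⟩ := exists_retract_koszulCokernel h
  have := isTorsionFree_koszulCokernel (x := var k 0) (isWeaklyRegular_var_two_var_three k)
  have hs : Function.Injective s := fun a b hab => by
    rw [← LinearMap.id_apply (R := R k) a, ← LinearMap.id_apply (R := R k) b, ← hrs]
    exact congrArg r hab
  exact hs.moduleIsTorsionFree s fun c x => map_smul s c x

theorem not_isReflexive_of_isAuslanderTranspose
    (h : IsAuslanderTranspose (R k) (R k ⧸ p k) N) : ¬ IsReflexive (R k) N := fun hN => by
  obtain ⟨s, r, hrs⟩ := exists_retract_of_koszulCokernel h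
  exact not_isReflexive_koszulCokernel (var_zero_mul_var_one k)
    (isWeaklyRegular_var_two_var_three k)
    (fun hy => var_one_notMem_p k (Ideal.span_mono (by simp) hy)) (IsReflexive.of_split s r hrs)

end Transpose

end Example

end TensorReflexive

theorem mainTheorem3 (k : Type u) [Field k] :
    -- `R` is a four-dimensional hypersurface
    TensorReflexive.IsHypersurface (TensorReflexive.R k) ∧
    ringKrullDim (TensorReflexive.R k) = 4 ∧
    -- `R/(y)` is maximal Cohen-Macaulay and satisfies `(S₃)` as an `R`-module
    TensorReflexive.IsMaximalCohenMacaulay (TensorReflexive.R k) (TensorReflexive.A k) ∧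
    TensorReflexive.SatisfiesSerre 3 (TensorReflexive.R k) (TensorReflexive.A k) ∧
    -- `𝔭 = (x, z, w)` is a prime ideal of height two
    ∃ hp : (TensorReflexive.p k).IsPrime,
      (TensorReflexive.p k).height = 2 ∧
      -- for every third syzygy `M` of the residue field over `R/(y)`
      ∀ (M : Type u) [AddCommGroup M] [Module (TensorReflexive.A k) M]
        [Module (TensorReflexive.R k) M]
        [IsScalarTower (TensorReflexive.R k) (TensorReflexive.A k) M],
        TensorReflexive.IsThirdSyzygy (TensorReflexive.A k)
          (IsLocalRing.ResidueField (TensorReflexive.A k)) M →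
        TensorReflexive.depth (TensorReflexive.R k) M = 3 ∧
        ¬ TensorReflexive.IsMaximalCohenMacaulay (TensorReflexive.R k) M ∧
        (⟨TensorReflexive.p k, hp⟩ : PrimeSpectrum (TensorReflexive.R k)) ∉
          Module.support (TensorReflexive.R k) M ∧
        TensorReflexive.SatisfiesSerre 3 (TensorReflexive.R k) M ∧
        Module.IsReflexive (TensorReflexive.R k) M ∧
        -- and every Auslander transpose `N` of `R/𝔭`
        ∀ (N : Type u) [AddCommGroup N] [Module (TensorReflexive.R k) N],
          TensorReflexive.IsAuslanderTranspose (TensorReflexive.R k)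
            (TensorReflexive.R k ⧸ TensorReflexive.p k) N →
          projectiveDimension (ModuleCat.of (TensorReflexive.R k) N) = 1 ∧
          (∀ i : ℕ, 1 ≤ i → Limits.IsZero
            (((Tor (ModuleCat.{u} (TensorReflexive.R k)) i).obj
              (ModuleCat.of (TensorReflexive.R k) M)).obj
                (ModuleCat.of (TensorReflexive.R k) N))) ∧
          Module.IsReflexive (TensorReflexive.R k) (M ⊗[TensorReflexive.R k] N) ∧
          Module.IsTorsionFree (TensorReflexive.R k) N ∧
          ¬ Module.IsReflexive (TensorReflexive.R k) N := by
  open TensorReflexive in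
  refine ⟨isHypersurface_R k, ringKrullDim_R k, isMaximalCohenMacaulay_A k,
    satisfiesSerre_of_isWeaklyRegular_A k fun _ _ h => h, isPrime_p k, height_p k, ?_⟩
  open TensorReflexive in
  intro M _ _ _ _ hM
  have hreg {l : List (Fin 5)} (hl : l.Nodup) (h1 : 1 ∉ l) (h3 : (l.map (var k)).length ≤ 3) :
      RingTheory.Sequence.IsWeaklyRegular M (l.map (var k)) :=
    isWeaklyRegular_of_isThirdSyzygy hM h3 (isWeaklyRegular_map_var k hl h1)
  have h023 := hreg (l := [0, 2, 3]) (by decide) (by decide) le_rfl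
  -- A separate sequence starting with z: embedding M ⊗ K and the Tor vanishing need z regular on M
  -- itself.
  have h23 := hreg (l := [2, 3]) (by decide) (by decide) (by simp)
  have hrefl := isReflexive_of_isThirdSyzygy hM
  refine ⟨depth_of_isThirdSyzygy hM, fun h => ?_, notMem_support_of_isScalarTower _,
    satisfiesSerre_of_isWeaklyRegular_A k fun _ hrs h => isWeaklyRegular_of_isThirdSyzygy hM hrs h,
    hrefl, fun N _ _ hN => ⟨projectiveDimension_of_isAuslanderTranspose hN,
      fun i hi => isZero_Tor_of_isAuslanderTranspose hN
        ((RingTheory.Sequence.isWeaklyRegular_cons_iff _ _ _).1 h23).1 hi,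
      isReflexive_tensor_of_isAuslanderTranspose hN hrefl h023 h23,
      isTorsionFree_of_isAuslanderTranspose hN, not_isReflexive_of_isAuslanderTranspose hN⟩⟩
  have := h.2
  rw [depth_of_isThirdSyzygy hM, ringKrullDim_R] at this
  exact absurd this (by decide)
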